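/- **Setting.** Let $\{p_{\theta,\eta}:\theta\in\Theta,\ \eta\in\mathcal H\}$ be a model of probability densities with respect to a $\sigma$-finite measure $\mu$ on $\mathcal X$, where $\Theta\subset\mathbb R$ and $\mathcal H$ is an arbitrary subset of a normed space $(E,\|\cdot\|)$. Let $(\theta_0,\eta_0)\in\Theta\times\mathcal H$ be the true parameter, $P=P_{\theta_0,\eta_0}$, $Pf=\int f\,dP$, and let $X_1,X_2,\dots$ be i.i.d. with law $P$. Write $\mathbb P_nf=n^{-1}\sum_{i\le n}f(X_i)$ and $\mathbb G_nf=\sqrt n(\mathbb P_nf-Pf)$. Let $\mathrm{lik}_n(\theta,\eta)=\prod_{i\le n}p_{\theta,\eta}(X_i)$ and $pl_n(\theta)=\sup_{\eta\in\mathcal H}\mathrm{lik}_n(\theta,\eta)$; let $\hat\eta_\theta$ maximize $\mathrm{lik}_n(\theta,\cdot)$ over $\mathcal H$ for each $\theta\in\Theta$, and let $\hat\theta_n$ be a $\Theta$-valued random variable that maximizes $pl_n$ over $\Theta$ (both for all large $n$, almost surely). Assume that $\hat\theta_n=\theta_0+o_P(1)$. For maps that are not measurable, probabilities are outer probabilities.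 Let $\dot\ell_{\theta_0,\eta_0}=\partial_\theta\log p_{\theta,\eta_0}|_{\theta=\theta_0}\in L_2(P)$ be the score for $\theta$. The nuisance scores are $\partial_s\log p_{\theta_0,\eta_s}|_{s=0}\in L_2(P)$, assumed to have $P$-mean $0$, along a given family of paths $s\mapsto\eta_s$ which lie in $\mathcal H$ for $s$ near $0$, tend to their value $\eta_0$ at $s=0$, and make $s\mapsto p_{\theta_0,\eta_s}(x)$ differentiable at $0$ for $P$-almost every $x$. The efficient score $\tilde\ell_0$ is $\dot\ell_{\theta_0,\eta_0}$ minus its $L_2(P)$-projection on the closed linear span of the nuisance scores, and $\tilde I_0$ is the variance of $\tilde\ell_0(X_1)$. Let $(t,\theta,\eta)\mapsto\eta_t(\theta,\eta)$ be a map, with values in $\mathcal H$ for $(t,\theta,\eta)$ in some neighbourhood of $(\theta_0,\theta_0,\eta_0)$ in $\Theta\times\Theta\times\mathcal H$, where moreover $p_{t,\eta_t(\theta,\eta)}(x)>0$ for all $x$. Put $\ell(t,\theta,\eta)(x)=\log p_{t,\eta_t(\theta,\eta)}(x)$ and write $\dot\ell,\ddot\ell,\ell^{(3)}$ for its derivatives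 in $t$ and $\ell_{t,\theta}=\partial_\theta\dot\ell$. The submodel $t\mapsto p_{t,\eta_t(\theta_0,\eta_0)}$ is least favorable at $(\theta_0,\eta_0)$: $\dot\ell_0:=\dot\ell(\theta_0,\theta_0,\eta_0)=\tilde\ell_0$ $P$-a.s. **Assumptions.** 1. $\Theta$ is compact and $\theta_0$ is an interior point of $\Theta$. 2. $\eta_\theta(\theta,\eta)=\eta$ for all $(\theta,\eta)\in\Theta\times\mathcal H$. 3. $\|\hat\eta_{\tilde\theta_n}-\eta_0\|=O_P(n^{-1/2}+|\tilde\theta_n-\theta_0|)$ for all random $\tilde\theta_n\in\Theta$ with $\tilde\theta_n=\theta_0+o_P(1)$. 4. In a neighbourhood of $(\theta_0,\theta_0,\eta_0)$ in $\mathbb R\times\mathbb R\times\mathcal H$ the derivatives $\partial_\theta^m\partial_t^l\,\ell(t,\theta,\eta)(x)$ with $(l,m)=(0,0),(1,0),(2,0),(3,0),(1,1),(1,2),(2,1)$ exist and have $P$-integrable envelopes. Moreover, for $(t,\theta)$ near $(\theta_0,\theta_0)$, the density $p_{t,\eta_t(\theta,\eta_0)}(x)$ is continuously differentiable in $(t,\theta)$,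 and its partial derivatives $\partial_t,\ \partial_t^2,\ \partial_\theta\partial_t$ are dominated by a $\mu$-integrable function of $x$. 5. For some neighbourhood $V$ of $(\theta_0,\theta_0,\eta_0)$ in $\Theta\times\Theta\times\mathcal H$, the classes $\{\ddot\ell(t,\theta,\eta):(t,\theta,\eta)\in V\}$ and $\{\ell_{t,\theta}(t,\theta,\eta):(t,\theta,\eta)\in V\}$ are $P$-Donsker and $\{\ell^{(3)}(t,\theta,\eta):(t,\theta,\eta)\in V\}$ is $P$-Glivenko–Cantelli. 6. For $\eta\in\mathcal H$ in some neighbourhood of $\eta_0$: $\mathbb G_n(\dot\ell(\theta_0,\theta_0,\eta)-\dot\ell_0)=O_P(\|\eta-\eta_0\|)$ uniformly in $\eta$; $P\ddot\ell(\theta_0,\theta_0,\eta)-P\ddot\ell(\theta_0,\theta_0,\eta_0)=O(\|\eta-\eta_0\|)$; $P\ell_{t,\theta}(\theta_0,\theta_0,\eta)-P\ell_{t,\theta}(\theta_0,\theta_0,\eta_0)=O(\|\eta-\eta_0\|)$; $P\dot\ell(\theta_0,\theta_0,\eta)=O(\|\eta-\eta_0\|^2)$. 7. $\tilde I_0>0$.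 **Theorem 1.** Under these assumptions, for every sequence of $\Theta$-valued random variables $\tilde\theta_n$ with $\tilde\theta_n-\hat\theta_n=o_P(1)$, $$\log pl_n(\tilde\theta_n)=\log pl_n(\hat\theta_n)-\frac n2(\tilde\theta_n-\hat\theta_n)^2\tilde I_0+O_P\bigl(n|\tilde\theta_n-\hat\theta_n|^3+n^{-1/2}\bigr),$$ and $$\sqrt n(\hat\theta_n-\theta_0)=\frac1{\sqrt n}\sum_{i=1}^n\tilde\ell_0(X_i)\tilde I_0^{-1}+O_P(n^{-1/2}).$$ -/

import Mathlib

open MeasureTheory ProbabilityTheory Filter Topology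
open scoped ENNReal BoundedContinuousFunction

namespace SemiparametricProfile

noncomputable section

/-! ## Stochastic order symbols -/

/-- `R n = O_P(r n)`: for every `ε > 0` there is `M` such that, for all large `n`,
`Pr(|R n| > M |r n|) ≤ ε`. For non-measurable maps `Pr` is the outer probability. -/
def IsBigOP {Ω : Type*} [MeasurableSpace Ω] (Pr : Measure Ω) (R r : ℕ → Ω → ℝ) : Prop :=
  ∀ ε : ℝ, 0 < ε → ∃ M : ℝ, ∀ᶠ n in atTop,
    Pr {ω | M * |r n ω| < |R n ω|} ≤ ENNReal.ofReal ε

/-! ## Empirical processes -/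

/-- `ℙ_n f = n⁻¹ ∑ f(X_i)` for the data `y = (X_1, …, X_n)`. -/
def empMean {𝒳 : Type*} {n : ℕ} (y : Fin n → 𝒳) (f : 𝒳 → ℝ) : ℝ :=
  (n : ℝ)⁻¹ * ∑ i, f (y i)

/-- `𝔾_n f = n^{-1/2} ∑ (f(X_i) - P f)` for the data `y = (X_1, …, X_n)`. -/
def empProc {𝒳 : Type*} [MeasurableSpace 𝒳] (P : Measure 𝒳) {n : ℕ} (y : Fin n → 𝒳)
    (f : 𝒳 → ℝ) : ℝ :=
  (Real.sqrt n)⁻¹ * ∑ i, (f (y i) - ∫ x, f x ∂P)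

/-- Outer expectation of a bounded real function, `E^* u = inf {E g : g ≥ u measurable, integrable}`. -/
def outerExp {α : Type*} [MeasurableSpace α] (Q : Measure α) (u : α → ℝ) : ℝ :=
  sInf {c | ∃ g : α → ℝ, Measurable g ∧ Integrable g Q ∧ (∀ a, u a ≤ g a) ∧ c = ∫ a, g a ∂Q}

/-- `F` is `P`-Donsker: `F ⊆ L₂(P)`, the paths of the empirical process lie in `ℓ^∞(F)`, and it
converges weakly in `ℓ^∞(F)` (in the sense of Hoffmann-Jørgensen, with outer expectations over the
product space) to a tight Borel law `ν`. -/
def IsDonsker {𝒳 : Type*} [MeasurableSpace 𝒳] (P : Measure 𝒳) (F : Set (𝒳 → ℝ)) : Prop :=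
  (∀ f ∈ F, MemLp f 2 P) ∧
  ∃ hb : ∀ (n : ℕ) (y : Fin n → 𝒳), Memℓp (fun f : F => empProc P y f.1) ∞,
  ∃ ν : @Measure (lp (fun _ : F => ℝ) ∞) (borel _),
    ν Set.univ = 1 ∧
    (∀ ε : ℝ≥0∞, 0 < ε → ∃ K : Set (lp (fun _ : F => ℝ) ∞), IsCompact K ∧ ν Kᶜ ≤ ε) ∧
    ∀ h : lp (fun _ : F => ℝ) ∞ →ᵇ ℝ,
      Tendsto (fun n : ℕ => outerExp (Measure.pi (fun _ : Fin n => P))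
          (fun y => h ⟨fun f : F => empProc P y f.1, hb n y⟩))
        atTop (𝓝 (@integral _ _ _ _ (borel _) ν (fun z => h z)))

/-- `F` is `P`-Glivenko-Cantelli: `F ⊆ L₁(P)` and `sup_{f ∈ F} |ℙ_n f - P f| → 0` in outer
probability. -/
def IsGlivenkoCantelli {𝒳 : Type*} [MeasurableSpace 𝒳] (P : Measure 𝒳) (F : Set (𝒳 → ℝ)) :
    Prop :=
  (∀ f ∈ F, Integrable f P) ∧
  ∀ ε : ℝ, 0 < ε → Tendsto (fun n : ℕ => Measure.pi (fun _ : Fin n => P)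
    {y | ∃ f ∈ F, ε < |empMean y f - ∫ x, f x ∂P|}) atTop (𝓝 0)

/-! ## The model -/

/-- A semiparametric model `{p_{θ,η} : θ ∈ Θ, η ∈ H}` of probability densities with respect to a
σ-finite measure `μ`, with `Θ ⊆ ℝ` and `H` a subset of a normed space, and its true parameter
`(θ₀, η₀)`. -/
structure Model (𝒳 : Type*) [MeasurableSpace 𝒳] (E : Type*) where
  μ : Measure 𝒳
  sigmaFinite : SigmaFinite μ
  Θ : Set ℝ
  H : Set E
  p : ℝ → E → 𝒳 → ℝ
  measurable_p : ∀ θ ∈ Θ, ∀ η ∈ H, Measurable (p θ η)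
  nonneg_p : ∀ θ ∈ Θ, ∀ η ∈ H, ∀ x, 0 ≤ p θ η x
  lintegral_p : ∀ θ ∈ Θ, ∀ η ∈ H, ∫⁻ x, ENNReal.ofReal (p θ η x) ∂μ = 1
  θ₀ : ℝ
  η₀ : E
  θ₀_mem : θ₀ ∈ Θ
  η₀_mem : η₀ ∈ H

namespace Model

variable {𝒳 : Type*} [MeasurableSpace 𝒳] {E : Type*}

/-- The true law `P = P_{θ₀,η₀}` of one observation. -/
def P (M : Model 𝒳 E) : Measure 𝒳 :=
  M.μ.withDensity (fun x => ENNReal.ofReal (M.p M.θ₀ M.η₀ x))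

/-- The full likelihood `lik_n(θ, η) = ∏ p_{θ,η}(X_i)` of the data `y`. -/
def lik (M : Model 𝒳 E) {n : ℕ} (y : Fin n → 𝒳) (θ : ℝ) (η : E) : ℝ :=
  ∏ i, M.p θ η (y i)

/-- The profile likelihood `pl_n(θ) = sup_η lik_n(θ, η)`. -/
def profileLik (M : Model 𝒳 E) {n : ℕ} (y : Fin n → 𝒳) (θ : ℝ) : ℝ :=
  ⨆ η : M.H, M.lik y θ η.1

/-- The score function for `θ` at `(θ₀, η₀)`. -/
def score (M : Model 𝒳 E) (x : 𝒳) : ℝ :=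
  deriv (fun θ => Real.log (M.p θ M.η₀ x)) M.θ₀

/-- The score function for `η` at `(θ₀, η₀)` along the path `s ↦ γ s` with `γ 0 = η₀`. -/
def nuisanceScore (M : Model 𝒳 E) (γ : ℝ → E) (x : 𝒳) : ℝ :=
  deriv (fun s => Real.log (M.p M.θ₀ (γ s) x)) 0

/-- The closed linear span in `L₂(P)` of the nuisance scores along the paths `γ h`, where the
direction `h` runs through the index set `D`. -/
abbrev nuisanceSpace (M : Model 𝒳 E) {D : Type*} (γ : D → ℝ → E) : Submodule ℝ (Lp ℝ 2 M.P) :=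
  (Submodule.span ℝ {g : Lp ℝ 2 M.P | ∃ h, g =ᵐ[M.P] M.nuisanceScore (γ h)}).topologicalClosure

/-- The efficient score function at `(θ₀, η₀)`: the score for `θ` minus its orthogonal projection
in `L₂(P)` on the closed linear span of the nuisance scores. -/
def efficientScore (M : Model 𝒳 E) {D : Type*} (γ : D → ℝ → E) (hS : MemLp M.score 2 M.P) :
    Lp ℝ 2 M.P :=
  hS.toLp M.score - (M.nuisanceSpace γ).starProjection (hS.toLp M.score)

/-- The efficient information at `(θ₀, η₀)`: the variance of the efficient score. -/
def efficientInfo (M : Model 𝒳 E) {D : Type*} (γ : D → ℝ → E) (hS : MemLp M.score 2 M.P) : ℝ :=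
  variance (M.efficientScore γ hS) M.P

/-- `ℓ(t, θ, η)(x) = log lik(t, η_t(θ, η))(x)`, where `σ t θ η` is `η_t(θ, η)`. -/
def ell (M : Model 𝒳 E) (σ : ℝ → ℝ → E → E) (t θ : ℝ) (η : E) (x : 𝒳) : ℝ :=
  Real.log (M.p t (σ t θ η) x)

/-- The partial derivative `∂^{l+m} / ∂t^l ∂θ^m` of `ℓ(t, θ, η)(x)`. -/
def dEll (M : Model 𝒳 E) (σ : ℝ → ℝ → E → E) (l m : ℕ) (t θ : ℝ) (η : E) (x : 𝒳) : ℝ :=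
  iteratedDeriv m (fun θ' => iteratedDeriv l (fun t' => M.ell σ t' θ' η x) t) θ

/-- The partial derivative `∂^{l+m} / ∂t^l ∂θ^m` of the density `p_{t, η_t(θ, η)}(x)`. -/
def dDens (M : Model 𝒳 E) (σ : ℝ → ℝ → E → E) (l m : ℕ) (t θ : ℝ) (η : E) (x : 𝒳) : ℝ :=
  iteratedDeriv m (fun θ' => iteratedDeriv l (fun t' => M.p t' (σ t' θ' η) x) t) θ

/-- The class of functions `{∂^{l+m} ℓ(t, θ, η) / ∂t^l ∂θ^m : (t, θ, η) ∈ V}`. -/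
def dEllClass (M : Model 𝒳 E) (σ : ℝ → ℝ → E → E) (V : Set (ℝ × ℝ × E)) (l m : ℕ) :
    Set (𝒳 → ℝ) :=
  (fun v : ℝ × ℝ × E => M.dEll σ l m v.1 v.2.1 v.2.2) '' V

/-- The paths `γ h`, `h ∈ D`, are admissible nuisance submodels: they stay in `H` near `0`, approach
`η₀` at `0`, are differentiable in the likelihood, and have nuisance scores in `L₂⁰(P)`. -/
structure IsNuisancePaths [NormedAddCommGroup E] (M : Model 𝒳 E) {D : Type*} (γ : D → ℝ → E) :
    Prop where
  zero : ∀ h, γ h 0 = M.η₀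
  tendsto : ∀ h, Tendsto (γ h) (𝓝 0) (𝓝 M.η₀)
  mem : ∀ h, ∀ᶠ s in 𝓝 (0 : ℝ), γ h s ∈ M.H
  diff : ∀ h, ∀ᵐ x ∂M.P, DifferentiableAt ℝ (fun s => M.p M.θ₀ (γ h s) x) 0
  memLp : ∀ h, MemLp (M.nuisanceScore (γ h)) 2 M.P
  mean_zero : ∀ h, ∫ x, M.nuisanceScore (γ h) x ∂M.P = 0

/-- The neighbourhood of `(θ₀, θ₀, η₀)` of radius `δ`; the components are `t`, `θ` and `η`. -/
def nhd [NormedAddCommGroup E] (M : Model 𝒳 E) (δ : ℝ) : Set (ℝ × ℝ × E) :=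
  {v | |v.1 - M.θ₀| < δ ∧ |v.2.1 - M.θ₀| < δ ∧ v.2.2 ∈ M.H ∧ ‖v.2.2 - M.η₀‖ < δ}

/-- The assumptions on the model and on the least favorable submodel `t ↦ η_t(θ, η) = σ t θ η`. -/
structure Regular [NormedAddCommGroup E] (M : Model 𝒳 E) {D : Type*} (γ : D → ℝ → E)
    (hS : MemLp M.score 2 M.P) (σ : ℝ → ℝ → E → E) : Prop where
  compact : IsCompact M.Θ
  interior : M.θ₀ ∈ interior M.Θ
  paths : M.IsNuisancePaths γ
  /-- The submodel passes through `(θ, η)`. -/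
  through : ∀ θ ∈ M.Θ, ∀ η ∈ M.H, σ θ θ η = η
  /-- The submodel is least favorable at `(θ₀, η₀)`. -/
  leastFavorable : M.dEll σ 1 0 M.θ₀ M.θ₀ M.η₀ =ᵐ[M.P] M.efficientScore γ hS
  /-- The submodel is defined near `(θ₀, θ₀, η₀)`, with values in the parameter set for `η` and
  a finite log-likelihood. -/
  domain : ∃ δ > 0, ∀ v ∈ M.nhd δ, v.1 ∈ M.Θ ∧ v.2.1 ∈ M.Θ ∧ σ v.1 v.2.1 v.2.2 ∈ M.H ∧
    ∀ x, 0 < M.p v.1 (σ v.1 v.2.1 v.2.2) x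
  /-- The partial derivatives of orders `(1,0)`, `(2,0)`, `(3,0)`, `(1,1)`, `(1,2)`, `(2,1)` exist
  near `(θ₀, θ₀, η₀)` and, with `ℓ` itself, have an envelope in `L₁(P)` there. -/
  smooth : ∃ δ > 0,
    (∀ v ∈ M.nhd δ, ∀ x,
      (∀ l ∈ ({0, 1, 2} : Set ℕ),
        DifferentiableAt ℝ (fun t => M.dEll σ l 0 t v.2.1 v.2.2 x) v.1) ∧
      (∀ lm ∈ ({(1, 0), (1, 1), (2, 0)} : Set (ℕ × ℕ)),
        DifferentiableAt ℝ (fun θ => M.dEll σ lm.1 lm.2 v.1 θ v.2.2 x) v.2.1)) ∧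
    ∃ F : 𝒳 → ℝ, Integrable F M.P ∧ ∀ v ∈ M.nhd δ, ∀ x,
      ∀ lm ∈ ({(0, 0), (1, 0), (2, 0), (3, 0), (1, 1), (1, 2), (2, 1)} : Set (ℕ × ℕ)),
        |M.dEll σ lm.1 lm.2 v.1 v.2.1 v.2.2 x| ≤ F x
  /-- The integral of the density `p_{t, η_t(θ, η₀)}` can be differentiated under the integral sign
  near `(θ₀, θ₀)`: the density is continuously differentiable in `(t, θ)`, and its partial
  derivatives of orders `(1,0)`, `(2,0)`, `(1,1)` are dominated by a `μ`-integrable function. -/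
  dominated : ∃ δ > 0,
    (∀ x, ContDiffOn ℝ 1 (fun u : ℝ × ℝ => M.p u.1 (σ u.1 u.2 M.η₀) x)
      (Metric.ball M.θ₀ δ ×ˢ Metric.ball M.θ₀ δ)) ∧
    ∃ G : 𝒳 → ℝ, Integrable G M.μ ∧ ∀ t ∈ Metric.ball M.θ₀ δ, ∀ θ ∈ Metric.ball M.θ₀ δ, ∀ x,
      ∀ lm ∈ ({(1, 0), (2, 0), (1, 1)} : Set (ℕ × ℕ)), |M.dDens σ lm.1 lm.2 t θ M.η₀ x| ≤ G x
  donsker : ∃ δ > 0, IsDonsker M.P (M.dEllClass σ (M.nhd δ) 2 0) ∧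
    IsDonsker M.P (M.dEllClass σ (M.nhd δ) 1 1) ∧
    IsGlivenkoCantelli M.P (M.dEllClass σ (M.nhd δ) 3 0)
  /-- Modulus of continuity of the empirical process, uniformly in a neighbourhood of `η₀`. -/
  modulus : ∃ δ > 0, ∀ ε : ℝ, 0 < ε → ∃ C : ℝ, ∀ᶠ n : ℕ in atTop,
    Measure.pi (fun _ : Fin n => M.P)
      {y | ∃ η ∈ M.H, ‖η - M.η₀‖ < δ ∧ C * ‖η - M.η₀‖ <
        |empProc M.P y (fun x =>
          M.dEll σ 1 0 M.θ₀ M.θ₀ η x - M.dEll σ 1 0 M.θ₀ M.θ₀ M.η₀ x)|} ≤ ENNReal.ofReal ε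
  mean_tt : ∃ δ > 0, ∃ C : ℝ, ∀ η ∈ M.H, ‖η - M.η₀‖ < δ →
    |∫ x, M.dEll σ 2 0 M.θ₀ M.θ₀ η x ∂M.P - ∫ x, M.dEll σ 2 0 M.θ₀ M.θ₀ M.η₀ x ∂M.P|
      ≤ C * ‖η - M.η₀‖
  mean_tθ : ∃ δ > 0, ∃ C : ℝ, ∀ η ∈ M.H, ‖η - M.η₀‖ < δ →
    |∫ x, M.dEll σ 1 1 M.θ₀ M.θ₀ η x ∂M.P - ∫ x, M.dEll σ 1 1 M.θ₀ M.θ₀ M.η₀ x ∂M.P|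
      ≤ C * ‖η - M.η₀‖
  noBias : ∃ δ > 0, ∃ C : ℝ, ∀ η ∈ M.H, ‖η - M.η₀‖ < δ →
    |∫ x, M.dEll σ 1 0 M.θ₀ M.θ₀ η x ∂M.P| ≤ C * ‖η - M.η₀‖ ^ 2
  info_pos : 0 < M.efficientInfo γ hS

/-- The observations `X_1, X_2, …` (here `X 0, X 1, …`) are i.i.d. with law `P`. -/
structure IsSample (M : Model 𝒳 E) {Ω : Type*} [MeasurableSpace Ω] (Pr : Measure Ω)
    (X : ℕ → Ω → 𝒳) : Prop where
  measurable : ∀ i, Measurable (X i)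
  indep : iIndepFun X Pr
  law : ∀ i, Measure.map (X i) Pr = M.P

end Model

/-- The first `n` observations. -/
def dataVec {𝒳 Ω : Type*} (X : ℕ → Ω → 𝒳) (n : ℕ) (ω : Ω) : Fin n → 𝒳 := fun i => X i ω

/-- `etaHat n ω θ` maximizes the likelihood of `X_1, …, X_n` over `η ∈ H`, for each `θ ∈ Θ`. -/
def Model.IsNuisanceMLE {𝒳 : Type*} [MeasurableSpace 𝒳] {E : Type*} (M : Model 𝒳 E)
    {Ω : Type*} [MeasurableSpace Ω] (Pr : Measure Ω) (X : ℕ → Ω → 𝒳) (etaHat : ℕ → Ω → ℝ → E) :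
    Prop :=
  ∀ᶠ n in atTop, ∀ᵐ ω ∂Pr, ∀ θ ∈ M.Θ, etaHat n ω θ ∈ M.H ∧
    ∀ η ∈ M.H, M.lik (dataVec X n ω) θ η ≤ M.lik (dataVec X n ω) θ (etaHat n ω θ)

/-- `thetaHat n` is a random variable in `Θ` that maximizes the profile likelihood of
`X_1, …, X_n` over `Θ`. -/
structure Model.IsMLE {𝒳 : Type*} [MeasurableSpace 𝒳] {E : Type*} (M : Model 𝒳 E)
    {Ω : Type*} [MeasurableSpace Ω] (Pr : Measure Ω) (X : ℕ → Ω → 𝒳) (thetaHat : ℕ → Ω → ℝ) :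
    Prop where
  measurable : ∀ n, Measurable (thetaHat n)
  mem : ∀ n ω, thetaHat n ω ∈ M.Θ
  max : ∀ᶠ n in atTop, ∀ᵐ ω ∂Pr, ∀ θ ∈ M.Θ,
    M.profileLik (dataVec X n ω) θ ≤ M.profileLik (dataVec X n ω) (thetaHat n ω)

/-- The nuisance estimator has the parametric rate:
`‖η̂_{θ̃_n} - η₀‖ = O_P(n^{-1/2} + |θ̃_n - θ₀|)` whenever `θ̃_n = θ₀ + o_P(1)`. -/
def Model.NuisanceRate {𝒳 : Type*} [MeasurableSpace 𝒳] {E : Type*} [NormedAddCommGroup E]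
    (M : Model 𝒳 E) {Ω : Type*} [MeasurableSpace Ω] (Pr : Measure Ω)
    (etaHat : ℕ → Ω → ℝ → E) : Prop :=
  ∀ θt : ℕ → Ω → ℝ, (∀ n, Measurable (θt n)) → (∀ n ω, θt n ω ∈ M.Θ) →
    TendstoInMeasure Pr θt atTop (fun _ => M.θ₀) →
    IsBigOP Pr (fun n ω => ‖etaHat n ω (θt n ω) - M.η₀‖)
      (fun n ω => (Real.sqrt n)⁻¹ + |θt n ω - M.θ₀|)

end

end SemiparametricProfile

/-! Write d = θ̃ - θ̂. The profile likelihood need not be smooth, but its ratio is trapped between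
two smooth ones. Since η̂_θ maximizes in η and t ↦ η_t(θ, η) passes through η at t = θ, log pl_n(θ̃)
- log pl_n(θ̂) lies between the log-likelihood ratios of t = θ̃ against t = θ̂ along the submodels
attached to (θ̂, η̂_θ̂) (below) and (θ̃, η̂_θ̃) (above): `Model.LocalRegular.log_profileLik_sub`.
Both are Taylor expanded at t = θ̂; the third-order remainder is controlled by the empirical mean of
the envelope.

It remains to evaluate ℙ_n ℓ̇ and ℙ_n ℓ̈ at θ̂. Differentiating ∫ p dμ = 1 gives Pℓ̇ = 0 and Pℓ̈ =
-Ĩ₀ at the truth. The mixed derivative has mean 0 too: perturbing θ in η_t(θ, η₀) produces the score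
minus the efficient score, which is orthogonal to the efficient score. With the no-bias and modulus
conditions, ℙ_n ℓ̇(a, b, η) = ℙ_n ℓ̃₀ - Ĩ₀(a - θ₀) + O((n^{-1/2} + |a - θ₀| + |b - θ₀| + ‖η -
η₀‖)²), so that b and η matter only at second order:
`Model.Regular.abs_empMean_dEll_one_zero_expansion`.

At (θ̂, θ̂, η̂_θ̂) the left side vanishes. The nuisance rate and consistency allow the quadratic
error to be absorbed, which gives the n^{-1/2} rate and the linear expansion of θ̂. Inserting the
latter at (θ̂, θ̃, η̂_θ̃) cancels the linear terms, so the first derivative in the upper bound is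
O((n^{-1/2} + |d|)²); in the lower bound it is 0. The errors n|d|(n^{-1/2} + |d|)² and nd²(n^{-1/2}
+ |d|) are O(n|d|³ + n^{-1/2}).

Probability enters only through events indexed by one constant K (`WithHighProb`); on them
everything is a deterministic inequality. They are combined by monotonicity and subadditivity alone,
so η̂ may be non-measurable. -/

namespace SemiparametricProfile

/-! ## Events of high probability -/

/-- The events `A K n`, indexed by a constant `K` and the sample size `n`, have probability
arbitrarily close to `1` for all large `n`, once `K` is large. -/
def WithHighProb {Ω : Type*} [MeasurableSpace Ω] (Pr : Measure Ω)
    (A : ℝ → ℕ → Ω → Prop) : Prop :=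
  ∀ ε : ℝ, 0 < ε → ∃ K₀ : ℝ, ∀ K, K₀ ≤ K → ∀ᶠ n in atTop,
    Pr {ω | ¬ A K n ω} ≤ ENNReal.ofReal ε

namespace WithHighProb

variable {Ω : Type*} [MeasurableSpace Ω] {Pr : Measure Ω}

theorem and {A B : ℝ → ℕ → Ω → Prop} (hA : WithHighProb Pr A) (hB : WithHighProb Pr B) :
    WithHighProb Pr (fun K n ω => A K n ω ∧ B K n ω) := by
  intro ε hε
  obtain ⟨K₁, h₁⟩ := hA (ε / 2) (half_pos hε)
  obtain ⟨K₂, h₂⟩ := hB (ε / 2) (half_pos hε)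
  refine ⟨max K₁ K₂, fun K hK => ?_⟩
  filter_upwards [h₁ K (le_trans (le_max_left _ _) hK),
    h₂ K (le_trans (le_max_right _ _) hK)] with n hn₁ hn₂
  calc Pr {ω | ¬ (A K n ω ∧ B K n ω)}
      ≤ Pr ({ω | ¬ A K n ω} ∪ {ω | ¬ B K n ω}) := by
        refine measure_mono fun ω hω => ?_
        simp only [Set.mem_ofPred_eq, Set.mem_union] at hω ⊢
        tauto
    _ ≤ Pr {ω | ¬ A K n ω} + Pr {ω | ¬ B K n ω} := measure_union_le _ _
    _ ≤ ENNReal.ofReal (ε / 2) + ENNReal.ofReal (ε / 2) := add_le_add hn₁ hn₂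
    _ = ENNReal.ofReal ε := by
        rw [← ENNReal.ofReal_add (half_pos hε).le (half_pos hε).le, add_halves]

theorem mono {A B : ℝ → ℕ → Ω → Prop} (hA : WithHighProb Pr A)
    (h : ∀ K n ω, A K n ω → B K n ω) : WithHighProb Pr B := by
  intro ε hε
  obtain ⟨K₁, h₁⟩ := hA ε hε
  refine ⟨K₁, fun K hK => ?_⟩
  filter_upwards [h₁ K hK] with n hn
  refine le_trans (measure_mono fun ω hω => ?_) hn
  exact fun hA => hω (h K n ω hA)

theorem of_ae {A : ℕ → Ω → Prop} (h : ∀ᶠ n in atTop, ∀ᵐ ω ∂Pr, A n ω) :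
    WithHighProb Pr (fun _ => A) := by
  intro ε hε
  refine ⟨0, fun K _ => ?_⟩
  filter_upwards [h] with n hn
  rw [ae_iff] at hn
  rw [hn]
  exact zero_le

theorem of_le (c : ℝ) : WithHighProb Pr (fun K _ _ => c ≤ K) := by
  intro ε hε
  refine ⟨c, fun K hK => Eventually.of_forall fun n => ?_⟩
  simp [hK]

theorem of_eventually {A : ℝ → ℕ → Prop} (h : ∀ K, 1 ≤ K → ∀ᶠ n in atTop, A K n) :
    WithHighProb Pr (fun K n _ => A K n) := by
  intro ε hε
  refine ⟨1, fun K hK => ?_⟩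
  filter_upwards [h K hK] with n hn
  simp [hn]

/-- The radius may shrink as K grows, because K is fixed before n tends to infinity. This makes
smallness conditions relative to K, such as δ / (2K), available. -/
theorem of_tendstoInMeasure {T : ℕ → Ω → ℝ} {c : ℝ}
    (h : TendstoInMeasure Pr T atTop (fun _ => c)) {ρ : ℝ → ℝ} (hρ : ∀ K, 1 ≤ K → 0 < ρ K) :
    WithHighProb Pr (fun K n ω => |T n ω - c| < ρ K) := by
  intro ε hε
  refine ⟨1, fun K hK => ?_⟩
  have h1 := tendstoInMeasure_iff_dist.mp h (ρ K) (hρ K hK)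
  filter_upwards [h1.eventually_le_const (ENNReal.ofReal_pos.mpr hε)] with n hn
  simpa [Real.dist_eq, not_lt] using hn

theorem of_isBigOP {R r : ℕ → Ω → ℝ} (h : IsBigOP Pr R r) :
    WithHighProb Pr (fun K n ω => |R n ω| ≤ K * |r n ω|) := by
  intro ε hε
  obtain ⟨M, hM⟩ := h ε hε
  refine ⟨M, fun K hK => ?_⟩
  filter_upwards [hM] with n hn
  refine le_trans (measure_mono fun ω hω => ?_) hn
  simp only [Set.mem_ofPred_eq, not_le] at hω ⊢
  exact lt_of_le_of_lt (mul_le_mul_of_nonneg_right hK (abs_nonneg _)) hω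

theorem isBigOP {R r : ℕ → Ω → ℝ} (B : ℝ → ℝ)
    (h : WithHighProb Pr (fun K n ω => |R n ω| ≤ B K * |r n ω|)) : IsBigOP Pr R r := by
  intro ε hε
  obtain ⟨K, hK⟩ := h ε hε
  refine ⟨B K, ?_⟩
  simpa only [not_le] using hK K le_rfl

end WithHighProb

theorem tendstoInMeasure_of_sub {Ω : Type*} [MeasurableSpace Ω] {Pr : Measure Ω}
    {T S : ℕ → Ω → ℝ} {c : ℝ}
    (hT : TendstoInMeasure Pr (fun n ω => T n ω - S n ω) atTop (fun _ => (0 : ℝ)))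
    (hS : TendstoInMeasure Pr S atTop (fun _ => c)) :
    TendstoInMeasure Pr T atTop (fun _ => c) := by
  rw [tendstoInMeasure_iff_dist] at *
  intro ε hε
  have h := (hT (ε / 2) (half_pos hε)).add (hS (ε / 2) (half_pos hε))
  rw [add_zero] at h
  refine tendsto_of_tendsto_of_tendsto_of_le_of_le tendsto_const_nhds h (fun _ => zero_le)
    fun n => (measure_mono fun ω hω => ?_).trans (measure_union_le _ _)
  simp only [Set.mem_union, Set.mem_ofPred_eq, Real.dist_eq, sub_zero] at hω ⊢
  by_contra! hcon
  have := abs_sub_le (T n ω) (S n ω) c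
  linarith [hcon.1, hcon.2]

/-! ## Donsker classes -/

theorem exists_measurable_of_outerExp_lt {α : Type*} [MeasurableSpace α] {Q : Measure α}
    [IsFiniteMeasure Q] {u : α → ℝ} {B c : ℝ} (hB : ∀ a, u a ≤ B) (h : outerExp Q u < c) :
    ∃ g : α → ℝ, Measurable g ∧ Integrable g Q ∧ (∀ a, u a ≤ g a) ∧ ∫ a, g a ∂Q < c := by
  -- The constant B is an integrable majorant, so the infimum is over a nonempty set and is not the
  -- default value 0.
  obtain ⟨_, ⟨g, hg, hgi, hug, rfl⟩, hd⟩ := exists_lt_of_csInf_lt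
    (show Set.Nonempty {c | ∃ g : α → ℝ, Measurable g ∧ Integrable g Q ∧ (∀ a, u a ≤ g a) ∧
      c = ∫ a, g a ∂Q} from ⟨_, fun _ => B, measurable_const, integrable_const B, hB, rfl⟩) h
  exact ⟨g, hg, hgi, hug, hd⟩

/-- Outer Markov inequality. -/
theorem measure_le_of_outerExp_lt {α : Type*} [MeasurableSpace α] {Q : Measure α}
    [IsFiniteMeasure Q] {u : α → ℝ} {B c : ℝ} (hu : ∀ a, 0 ≤ u a) (hB : ∀ a, u a ≤ B)
    (h : outerExp Q u < c) : Q {a | 1 ≤ u a} ≤ ENNReal.ofReal c := by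
  obtain ⟨g, hg, hgi, hug, hgc⟩ := exists_measurable_of_outerExp_lt hB h
  have h0 : 0 ≤ᵐ[Q] g := ae_of_all _ fun a => (hu a).trans (hug a)
  have h1 := mul_meas_ge_le_integral_of_nonneg h0 hgi 1
  rw [one_mul] at h1
  have h2 : Q {a | 1 ≤ u a} ≤ Q {a | 1 ≤ g a} :=
    measure_mono fun a ha => le_trans (show 1 ≤ u a from ha) (hug a)
  refine h2.trans ?_
  rw [ENNReal.le_ofReal_iff_toReal_le (measure_ne_top _ _)
    ((integral_nonneg_of_ae h0).trans hgc.le)]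
  exact h1.trans hgc.le

/-- The function `z ↦ min(1, max(0, ‖z‖ - C))`. -/
noncomputable def normExcess (W : Type*) [NormedAddCommGroup W] (C : ℝ) : W →ᵇ ℝ :=
  BoundedContinuousFunction.ofNormedAddCommGroup (fun z => min 1 (max 0 (‖z‖ - C)))
    (by fun_prop) 1 (fun z => by
      rw [Real.norm_of_nonneg (le_min zero_le_one (le_max_left _ _))]
      exact min_le_left _ _)

theorem normExcess_apply {W : Type*} [NormedAddCommGroup W] (C : ℝ) (z : W) :
    normExcess W C z = min 1 (max 0 (‖z‖ - C)) := rfl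

theorem normExcess_nonneg {W : Type*} [NormedAddCommGroup W] (C : ℝ) (z : W) :
    0 ≤ normExcess W C z :=
  le_min zero_le_one (le_max_left _ _)

theorem normExcess_le_one {W : Type*} [NormedAddCommGroup W] (C : ℝ) (z : W) :
    normExcess W C z ≤ 1 :=
  min_le_left _ _

theorem integral_normExcess_le {W : Type*} [NormedAddCommGroup W] [MeasurableSpace W]
    [BorelSpace W] {ν : Measure W} (hν : ν Set.univ = 1) {K : Set W} (hK : IsCompact K) {C ε : ℝ}
    (hε : 0 ≤ ε) (hC : ∀ z ∈ K, ‖z‖ ≤ C) (hKε : ν Kᶜ ≤ ENNReal.ofReal ε) :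
    ∫ z, normExcess W C z ∂ν ≤ ε := by
  have : IsProbabilityMeasure ν := ⟨hν⟩
  have hmeas : MeasurableSet Kᶜ := hK.isClosed.measurableSet.compl
  calc ∫ z, normExcess W C z ∂ν ≤ ∫ z, Kᶜ.indicator (fun _ => (1 : ℝ)) z ∂ν := by
        refine integral_mono_of_nonneg (ae_of_all _ fun z => normExcess_nonneg C z)
          ((integrable_const (1 : ℝ)).indicator hmeas) (ae_of_all _ fun z => ?_)
        by_cases hz : z ∈ K
        · simp [normExcess_apply, hz, hC z hz]
        · simp [normExcess_apply, hz]
    _ = ν.real Kᶜ := by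
        rw [integral_indicator hmeas]
        simp
    _ ≤ ε := ENNReal.toReal_le_of_le_ofReal hε hKε

/-- The empirical process is bounded in probability uniformly over a Donsker class. -/
theorem IsDonsker.exists_bound {𝒳 : Type*} [MeasurableSpace 𝒳] {P : Measure 𝒳}
    [IsProbabilityMeasure P] {F : Set (𝒳 → ℝ)} (hF : IsDonsker P F) {ε : ℝ} (hε : 0 < ε) :
    ∃ C : ℝ, ∀ᶠ n : ℕ in atTop, Measure.pi (fun _ : Fin n => P)
      {y | ∃ f ∈ F, C < |empProc P y f|} ≤ ENNReal.ofReal ε := by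
  obtain ⟨-, hb, ν, hν, htight, hconv⟩ := hF
  -- Tightness of the limit supplies a compact, hence norm-bounded, set. The limit integral of the
  -- test function is then at most ε / 2, and weak convergence brings the outer expectations below
  -- ε.
  obtain ⟨K, hK, hKε⟩ := htight (ENNReal.ofReal (ε / 2)) (ENNReal.ofReal_pos.mpr (half_pos hε))
  obtain ⟨C, hC⟩ := hK.isBounded.exists_norm_le
  let _ : MeasurableSpace (lp (fun _ : F => ℝ) ∞) := borel _
  have : BorelSpace (lp (fun _ : F => ℝ) ∞) := ⟨rfl⟩
  have hint : ∫ z, normExcess (lp (fun _ : F => ℝ) ∞) C z ∂ν ≤ ε / 2 :=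
    integral_normExcess_le hν hK (half_pos hε).le hC hKε
  refine ⟨C + 1, ?_⟩
  filter_upwards [(hconv (normExcess _ C)).eventually_lt_const
    (lt_of_le_of_lt hint (half_lt_self hε))] with n hn
  refine le_trans (measure_mono (t := {y | 1 ≤ normExcess (lp (fun _ : F => ℝ) ∞) C
      ⟨fun f : F => empProc P y f.1, hb n y⟩}) ?_) (measure_le_of_outerExp_lt (B := 1)
    (fun y => normExcess_nonneg C _) (fun y => normExcess_le_one C _) (c := ε) hn)
  rintro y ⟨f, hf, hlt⟩
  rw [Set.mem_ofPred_eq, normExcess_apply]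
  refine le_min le_rfl (le_max_of_le_right ?_)
  have := lp.norm_apply_le_norm ENNReal.top_ne_zero
    (⟨fun f : F => empProc P y f.1, hb n y⟩ : lp (fun _ : F => ℝ) ∞) ⟨f, hf⟩
  rw [Real.norm_eq_abs] at this
  have h2 : |empProc P y f| ≤
    ‖(⟨fun f : F => empProc P y f.1, hb n y⟩ : lp (fun _ : F => ℝ) ∞)‖ := this
  linarith

/-! ## Samples -/

section Sample

variable {𝒳 : Type*} [MeasurableSpace 𝒳] {E : Type*} {M : Model 𝒳 E}
  {Ω : Type*} [MeasurableSpace Ω] {Pr : Measure Ω} {X : ℕ → Ω → 𝒳}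

instance Model.isProbabilityMeasure_P (M : Model 𝒳 E) : IsProbabilityMeasure M.P := by
  refine ⟨?_⟩
  rw [Model.P, withDensity_apply _ MeasurableSet.univ, Measure.restrict_univ]
  exact M.lintegral_p _ M.θ₀_mem _ M.η₀_mem

theorem Model.IsSample.measurable_dataVec (hX : M.IsSample Pr X) (n : ℕ) :
    Measurable (dataVec X n) :=
  measurable_pi_lambda _ fun i => hX.measurable i

theorem Model.IsSample.map_dataVec [IsProbabilityMeasure Pr] (hX : M.IsSample Pr X) (n : ℕ) :
    Measure.map (dataVec X n) Pr = Measure.pi (fun _ : Fin n => M.P) := by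
  have h1 : iIndepFun (fun i : Fin n => X i) Pr := hX.indep.precomp Fin.val_injective
  have h2 := (iIndepFun_iff_map_fun_eq_pi_map
    (fun i : Fin n => (hX.measurable i).aemeasurable)).mp h1
  simp only [hX.law] at h2
  exact h2

/-- For a non-measurable S only this inequality between outer probabilities is available in general:
a measurable cover of S pulls back to a cover of the event. It is the direction needed to move
bounds from the product space to Ω. -/
theorem Model.IsSample.measure_dataVec_le [IsProbabilityMeasure Pr] (hX : M.IsSample Pr X)
    (n : ℕ) (S : Set (Fin n → 𝒳)) :
    Pr {ω | dataVec X n ω ∈ S} ≤ Measure.pi (fun _ : Fin n => M.P) S := by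
  rw [← hX.map_dataVec]
  exact Measure.le_map_apply (hX.measurable_dataVec n).aemeasurable S

theorem Model.IsSample.withHighProb [IsProbabilityMeasure Pr] (hX : M.IsSample Pr X)
    {B : ℝ → (n : ℕ) → (Fin n → 𝒳) → Prop} (hB : ∀ C K n y, C ≤ K → B C n y → B K n y)
    (h : ∀ ε : ℝ, 0 < ε → ∃ C : ℝ, ∀ᶠ n : ℕ in atTop,
      Measure.pi (fun _ : Fin n => M.P) {y | ¬ B C n y} ≤ ENNReal.ofReal ε) :
    WithHighProb Pr (fun K n ω => B K n (dataVec X n ω)) := by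
  intro ε hε
  obtain ⟨C, hC⟩ := h ε hε
  refine ⟨C, fun K hK => ?_⟩
  filter_upwards [hC] with n hn
  refine le_trans (measure_mono fun ω hω => ?_) ((hX.measure_dataVec_le n _).trans hn)
  exact fun hc => hω (hB C K n _ hK hc)

theorem Model.IsSample.map_eq (hX : M.IsSample Pr X) (i : ℕ) :
    MeasurePreserving (X i) Pr M.P :=
  ⟨hX.measurable i, hX.law i⟩

theorem Model.IsSample.withHighProb_of_isDonsker [IsProbabilityMeasure Pr]
    (hX : M.IsSample Pr X) {𝓕 : Set (𝒳 → ℝ)}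
    (h : IsDonsker M.P 𝓕) :
    WithHighProb Pr (fun K n ω => ∀ f ∈ 𝓕, |empProc M.P (dataVec X n ω) f| ≤ K) := by
  refine hX.withHighProb (B := fun K n y => ∀ f ∈ 𝓕, |empProc M.P y f| ≤ K)
    (fun C K n y hCK h f hf => (h f hf).trans hCK) fun ε hε => ?_
  obtain ⟨C, hC⟩ := h.exists_bound hε
  refine ⟨C, hC.mono fun n hn => ?_⟩
  convert hn using 4
  push Not
  rfl

/-- The empirical mean of a nonnegative integrable function is bounded in probability. -/
theorem Model.IsSample.withHighProb_empMean [IsProbabilityMeasure Pr] (hX : M.IsSample Pr X)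
    {F : 𝒳 → ℝ} (hF : Integrable F M.P) (h0 : ∀ x, 0 ≤ F x) :
    WithHighProb Pr (fun K n ω => empMean (dataVec X n ω) F ≤ K) := by
  intro ε hε
  have hI : 0 ≤ ∫ x, F x ∂M.P := integral_nonneg h0
  -- Markov's inequality; the summand 1 keeps K positive when the integral vanishes.
  refine ⟨(∫ x, F x ∂M.P) / ε + 1, fun K hK => Eventually.of_forall fun n => ?_⟩
  have hKpos : 0 < K := lt_of_lt_of_le (by positivity) hK
  have hint : ∀ i : Fin n, Integrable (fun ω => F (X i ω)) Pr := fun i =>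
    (hX.map_eq i).integrable_comp_of_integrable hF
  have hint' : Integrable (fun ω => empMean (dataVec X n ω) F) Pr :=
    (integrable_finsetSum _ fun i _ => hint i).const_mul _
  have hnn : ∀ ω, 0 ≤ empMean (dataVec X n ω) F := fun ω =>
    mul_nonneg (by positivity) (Finset.sum_nonneg fun i _ => h0 _)
  have hval : ∫ ω, empMean (dataVec X n ω) F ∂Pr ≤ ∫ x, F x ∂M.P := by
    simp only [empMean, dataVec]
    rw [integral_const_mul, integral_finsetSum _ fun i _ => hint i]
    have : ∀ i : Fin n, ∫ ω, F (X i ω) ∂Pr = ∫ x, F x ∂M.P := fun i => by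
      rw [← hX.law i, integral_map (hX.measurable i).aemeasurable]
      rw [hX.law i]
      exact hF.aestronglyMeasurable
    simp only [this, Finset.sum_const, Finset.card_univ, Fintype.card_fin, nsmul_eq_mul]
    rcases Nat.eq_zero_or_pos n with rfl | hn
    · simpa using hI
    · rw [inv_mul_cancel_left₀ (by positivity)]
  have h1 := mul_meas_ge_le_integral_of_nonneg (ae_of_all Pr hnn) hint' K
  have h2 : Pr {ω | ¬ empMean (dataVec X n ω) F ≤ K} ≤
      Pr {ω | K ≤ empMean (dataVec X n ω) F} :=
    measure_mono fun ω hω => (not_le.mp hω).le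
  refine h2.trans ?_
  rw [ENNReal.le_ofReal_iff_toReal_le (measure_ne_top _ _) hε.le]
  have h3 : (∫ x, F x ∂M.P) ≤ ε * K := by
    have : (∫ x, F x ∂M.P) / ε ≤ K := by linarith
    rwa [div_le_iff₀ hε, mul_comm] at this
  have h4 : K * (Pr {ω | K ≤ empMean (dataVec X n ω) F}).toReal ≤ K * ε := by
    rw [measureReal_def] at h1
    linarith
  exact le_of_mul_le_mul_left h4 hKpos

/-- The empirical mean of a centred square integrable function is `O_P(n^{-1/2})`. -/
theorem Model.IsSample.withHighProb_empMean_centered [IsProbabilityMeasure Pr]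
    (hX : M.IsSample Pr X) {f : 𝒳 → ℝ} (hfm : Measurable f) (hf : MemLp f 2 M.P)
    (h0 : ∫ x, f x ∂M.P = 0) :
    WithHighProb Pr (fun K n ω => |empMean (dataVec X n ω) f| ≤ K * (Real.sqrt n)⁻¹) := by
  intro ε hε
  have hV : 0 ≤ Var[f; M.P] := variance_nonneg _ _
  set V := Var[f; M.P] with hVdef
  -- Chebyshev's inequality needs V ≤ ε * K ^ 2. The choice gives V ≤ ε * K, and the summand 1 gives
  -- K ≤ K ^ 2.
  refine ⟨V / ε + 1, fun K hK => ?_⟩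
  filter_upwards [eventually_gt_atTop 0] with n hn
  have hn' : (0 : ℝ) < n := by exact_mod_cast hn
  have hs : 0 < (Real.sqrt n)⁻¹ := by positivity
  have hK1 : 1 ≤ K := le_trans (by have : 0 ≤ V / ε := by positivity
                                   linarith) hK
  have hLp : ∀ i : Fin n, MemLp (fun ω => f (X i ω)) 2 Pr := fun i =>
    hf.comp_measurePreserving (hX.map_eq i)
  have hmean : ∀ i : Fin n, ∫ ω, f (X i ω) ∂Pr = 0 := fun i => by
    rw [← h0, ← hX.law i, integral_map (hX.measurable i).aemeasurable]
    rw [hX.law i]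
    exact hf.aestronglyMeasurable
  have hvar : ∀ i : Fin n, Var[fun ω => f (X i ω); Pr] = V := fun i => by
    rw [hVdef, ← hX.law i, variance_map]
    · rfl
    · exact hfm.aemeasurable
    · exact (hX.measurable i).aemeasurable
  set S : Ω → ℝ := ∑ i : Fin n, fun ω => f (X i ω) with hS
  have hSLp : MemLp S 2 Pr := memLp_finsetSum' _ fun i _ => hLp i
  have hSapp : ∀ ω, S ω = ∑ i : Fin n, f (X i ω) := fun ω => by simp [hS]
  have hSmean : ∫ ω, S ω ∂Pr = 0 := by
    simp only [hSapp]
    rw [integral_finsetSum _ fun i _ => (hLp i).integrable one_le_two]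
    simp [hmean]
  have hSvar : Var[S; Pr] = n * V := by
    rw [hS, IndepFun.variance_sum (fun i _ => hLp i)]
    · simp [hvar]
    · intro i _ j _ hij
      exact (hX.indep.indepFun (fun h => hij (Fin.ext h))).comp hfm hfm
  have hc : 0 < K * Real.sqrt n := by positivity
  have hcheb := meas_ge_le_variance_div_sq hSLp hc
  rw [hSmean, hSvar] at hcheb
  refine le_trans (measure_mono fun ω hω => ?_) (hcheb.trans ?_)
  · simp only [Set.mem_ofPred_eq, not_le, sub_zero] at hω ⊢
    rw [hSapp]
    have h1 : |empMean (dataVec X n ω) f| = (n : ℝ)⁻¹ * |∑ i : Fin n, f (X i ω)| := by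
      simp only [empMean, dataVec]
      rw [abs_mul, abs_of_pos (inv_pos.mpr hn')]
    rw [h1, inv_mul_eq_div, lt_div_iff₀ hn'] at hω
    have h2 : K * (Real.sqrt n)⁻¹ * n = K * Real.sqrt n := by
      have : Real.sqrt n * Real.sqrt n = n := Real.mul_self_sqrt hn'.le
      field_simp
      nlinarith
    linarith
  · refine ENNReal.ofReal_le_ofReal ?_
    rw [mul_pow, Real.sq_sqrt hn'.le, div_le_iff₀ (by positivity)]
    have h3 : V ≤ ε * K := by
      have : V / ε ≤ K := by linarith
      rwa [div_le_iff₀ hε, mul_comm] at this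
    have h4 : ε * K ≤ ε * K ^ 2 := by
      have : K ≤ K ^ 2 := by nlinarith
      exact mul_le_mul_of_nonneg_left this hε.le
    nlinarith

end Sample

end SemiparametricProfile

namespace SemiparametricProfile

/-! ## Differentiation under the integral sign -/

/-- The derivative is a pointwise limit of difference quotients along a sequence tending to t₀; the
sequence is shifted by N into the region where f t is measurable. -/
theorem measurable_deriv_of_eventually {α : Type*} [MeasurableSpace α] {f : ℝ → α → ℝ} {t₀ : ℝ}
    (hf : ∀ᶠ t in 𝓝 t₀, Measurable (f t)) (hd : ∀ x, DifferentiableAt ℝ (fun t => f t x) t₀) :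
    Measurable (fun x => deriv (fun t => f t x) t₀) := by
  obtain ⟨u, hu⟩ := exists_seq_tendsto (𝓝[≠] t₀)
  have hev : ∀ᶠ n in atTop, Measurable (f (u n)) :=
    (tendsto_nhdsWithin_iff.mp hu).1.eventually hf
  obtain ⟨N, hN⟩ := eventually_atTop.mp hev
  have hu' : Tendsto (fun n => u (n + N)) atTop (𝓝[≠] t₀) := hu.comp (tendsto_add_atTop_nat N)
  refine measurable_of_tendsto_metrizable
    (f := fun n x => (u (n + N) - t₀)⁻¹ * (f (u (n + N)) x - f t₀ x)) (fun n => ?_) ?_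
  · exact ((hN _ (Nat.le_add_left _ _)).sub hf.self_of_nhds).const_mul _
  · rw [tendsto_pi_nhds]
    intro x
    have h1 := (hasDerivAt_iff_tendsto_slope.mp (hd x).hasDerivAt).comp hu'
    refine h1.congr fun n => ?_
    simp [slope_def_field, div_eq_inv_mul]

/-- If `∫ f(t) dμ` does not depend on `t` near `t₀`, then `∫ ∂_t f(t₀) dμ = 0`. -/
theorem integral_deriv_eq_zero {α : Type*} [MeasurableSpace α] {μ : Measure α}
    {f f' : ℝ → α → ℝ} {G : α → ℝ} {t₀ c : ℝ} {s : Set ℝ} (hs : s ∈ 𝓝 t₀)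
    (hm : ∀ t ∈ s, Measurable (f t)) (hi : Integrable (f t₀) μ)
    (hd : ∀ t ∈ s, ∀ x, HasDerivAt (fun t => f t x) (f' t x) t)
    (hG : Integrable G μ) (hb : ∀ t ∈ s, ∀ x, |f' t x| ≤ G x)
    (hc : ∀ t ∈ s, ∫ x, f t x ∂μ = c) : ∫ x, f' t₀ x ∂μ = 0 := by
  have ht₀ : t₀ ∈ s := mem_of_mem_nhds hs
  have hm' : ∀ᶠ t in 𝓝 t₀, Measurable (f t) := Filter.mem_of_superset hs hm
  have hf' : Measurable (f' t₀) := by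
    have h := measurable_deriv_of_eventually hm' fun x => (hd t₀ ht₀ x).differentiableAt
    exact (funext fun x => (hd t₀ ht₀ x).deriv : _ = f' t₀) ▸ h
  have h := (hasDerivAt_integral_of_dominated_loc_of_deriv_le (𝕜 := ℝ) hs
    (hm'.mono fun t ht => ht.aestronglyMeasurable) hi hf'.aestronglyMeasurable
    (ae_of_all μ fun x t ht => hb t ht x) hG (ae_of_all μ fun x t ht => hd t ht x)).2
  have h0 : HasDerivAt (fun t => ∫ x, f t x ∂μ) 0 t₀ :=
    (hasDerivAt_const t₀ c).congr_of_eventuallyEq (Filter.mem_of_superset hs hc)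
  exact h.unique h0

theorem eventually_abs_sub_lt {a c δ : ℝ} (h : |a - c| < δ) : ∀ᶠ t in 𝓝 a, |t - c| < δ :=
  (continuous_id.sub continuous_const).abs.continuousAt.eventually_lt continuousAt_const h

theorem mem_ball_of_abs_sub_lt {t c δ : ℝ} (ht : |t - c| < δ) : t ∈ Metric.ball c δ := by
  simpa [Metric.mem_ball, Real.dist_eq] using ht

/-! ### Derivatives of the log-likelihood and the density near the truth -/

namespace Model

variable {𝒳 : Type*} [MeasurableSpace 𝒳] {E : Type*} {M : Model 𝒳 E} {σ : ℝ → ℝ → E → E}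

theorem dEll_zero_zero (t θ : ℝ) (η : E) (x : 𝒳) :
    M.dEll σ 0 0 t θ η x = Real.log (M.p t (σ t θ η) x) := by
  simp [dEll, ell, iteratedDeriv_zero]

theorem deriv_dEll_left (l : ℕ) (t θ : ℝ) (η : E) (x : 𝒳) :
    deriv (fun t => M.dEll σ l 0 t θ η x) t = M.dEll σ (l + 1) 0 t θ η x := by
  simp [dEll, iteratedDeriv_zero, iteratedDeriv_succ]

theorem deriv_dEll_right (l m : ℕ) (t θ : ℝ) (η : E) (x : 𝒳) :
    deriv (fun θ => M.dEll σ l m t θ η x) θ = M.dEll σ l (m + 1) t θ η x := by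
  simp only [dEll, iteratedDeriv_succ (n := m)]

theorem dDens_one_zero (t θ : ℝ) (η : E) (x : 𝒳) :
    M.dDens σ 1 0 t θ η x = deriv (fun t => M.p t (σ t θ η) x) t := by
  simp [dDens, iteratedDeriv_zero, iteratedDeriv_one]

theorem dDens_two_zero (t θ : ℝ) (η : E) (x : 𝒳) :
    M.dDens σ 2 0 t θ η x = deriv (fun t => M.dDens σ 1 0 t θ η x) t := by
  simp [dDens, iteratedDeriv_zero, iteratedDeriv_succ]

theorem dDens_one_one (t θ : ℝ) (η : E) (x : 𝒳) :
    M.dDens σ 1 1 t θ η x = deriv (fun θ => M.dDens σ 1 0 t θ η x) θ := by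
  simp [dDens, iteratedDeriv_zero, iteratedDeriv_one]

theorem integral_P (f : 𝒳 → ℝ) :
    ∫ x, f x ∂M.P = ∫ x, M.p M.θ₀ M.η₀ x * f x ∂M.μ := by
  have hm := M.measurable_p _ M.θ₀_mem _ M.η₀_mem
  rw [P, integral_withDensity_eq_integral_toReal_smul hm.ennreal_ofReal
    (ae_of_all _ fun _ => ENNReal.ofReal_lt_top)]
  simp [ENNReal.toReal_ofReal (M.nonneg_p _ M.θ₀_mem _ M.η₀_mem _)]

theorem integral_p {θ : ℝ} (hθ : θ ∈ M.Θ) {η : E} (hη : η ∈ M.H) : ∫ x, M.p θ η x ∂M.μ = 1 := by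
  rw [integral_eq_lintegral_of_nonneg_ae (ae_of_all _ (M.nonneg_p _ hθ _ hη))
    (M.measurable_p _ hθ _ hη).aestronglyMeasurable, M.lintegral_p _ hθ _ hη, ENNReal.toReal_one]

theorem integrable_p {θ : ℝ} (hθ : θ ∈ M.Θ) {η : E} (hη : η ∈ M.H) :
    Integrable (M.p θ η) M.μ := by
  -- A non-integrable function has Bochner integral 0 by convention, whereas the density integrates
  -- to 1.
  by_contra h
  have h1 := integral_p hθ hη
  rw [integral_undef h] at h1
  exact zero_ne_one h1

variable [NormedAddCommGroup E]

theorem nhd_mono {δ δ' : ℝ} (h : δ ≤ δ') : M.nhd δ ⊆ M.nhd δ' :=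
  fun _ hv => ⟨hv.1.trans_le h, hv.2.1.trans_le h, hv.2.2.1, hv.2.2.2.trans_le h⟩

theorem mem_nhd_center {δ : ℝ} (hδ : 0 < δ) {t θ : ℝ} (ht : |t - M.θ₀| < δ)
    (hθ : |θ - M.θ₀| < δ) : (t, θ, M.η₀) ∈ M.nhd δ :=
  ⟨ht, hθ, M.η₀_mem, by simpa using hδ⟩

/-- The regularity conditions on a common neighbourhood of radius `δ`, with a common envelope `F`
of the derivatives of the log-likelihood, a common dominating function `G` of the derivatives of
the density, and a common constant `C`. -/
structure LocalRegular (M : Model 𝒳 E) (σ : ℝ → ℝ → E → E) (δ : ℝ) (F G : 𝒳 → ℝ) (C : ℝ) :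
    Prop where
  pos : 0 < δ
  through : ∀ θ ∈ M.Θ, ∀ η ∈ M.H, σ θ θ η = η
  domain : ∀ v ∈ M.nhd δ, v.1 ∈ M.Θ ∧ v.2.1 ∈ M.Θ ∧ σ v.1 v.2.1 v.2.2 ∈ M.H ∧
    ∀ x, 0 < M.p v.1 (σ v.1 v.2.1 v.2.2) x
  differentiable_left : ∀ v ∈ M.nhd δ, ∀ x, ∀ l ∈ ({0, 1, 2} : Set ℕ),
    DifferentiableAt ℝ (fun t => M.dEll σ l 0 t v.2.1 v.2.2 x) v.1
  differentiable_right : ∀ v ∈ M.nhd δ, ∀ x, ∀ lm ∈ ({(1, 0), (1, 1), (2, 0)} : Set (ℕ × ℕ)),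
    DifferentiableAt ℝ (fun θ => M.dEll σ lm.1 lm.2 v.1 θ v.2.2 x) v.2.1
  integrable_envelope : Integrable F M.P
  envelope : ∀ v ∈ M.nhd δ, ∀ x,
    ∀ lm ∈ ({(0, 0), (1, 0), (2, 0), (3, 0), (1, 1), (1, 2), (2, 1)} : Set (ℕ × ℕ)),
      |M.dEll σ lm.1 lm.2 v.1 v.2.1 v.2.2 x| ≤ F x
  contDiff : ∀ x, ContDiffOn ℝ 1 (fun u : ℝ × ℝ => M.p u.1 (σ u.1 u.2 M.η₀) x)
    (Metric.ball M.θ₀ δ ×ˢ Metric.ball M.θ₀ δ)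
  integrable_dominating : Integrable G M.μ
  dominated : ∀ t ∈ Metric.ball M.θ₀ δ, ∀ θ ∈ Metric.ball M.θ₀ δ, ∀ x,
    ∀ lm ∈ ({(1, 0), (2, 0), (1, 1)} : Set (ℕ × ℕ)), |M.dDens σ lm.1 lm.2 t θ M.η₀ x| ≤ G x
  memLp_tt : ∀ v ∈ M.nhd δ, MemLp (M.dEll σ 2 0 v.1 v.2.1 v.2.2) 2 M.P
  memLp_tθ : ∀ v ∈ M.nhd δ, MemLp (M.dEll σ 1 1 v.1 v.2.1 v.2.2) 2 M.P
  mean_tt : ∀ η ∈ M.H, ‖η - M.η₀‖ < δ →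
    |∫ x, M.dEll σ 2 0 M.θ₀ M.θ₀ η x ∂M.P - ∫ x, M.dEll σ 2 0 M.θ₀ M.θ₀ M.η₀ x ∂M.P|
      ≤ C * ‖η - M.η₀‖
  mean_tθ : ∀ η ∈ M.H, ‖η - M.η₀‖ < δ →
    |∫ x, M.dEll σ 1 1 M.θ₀ M.θ₀ η x ∂M.P - ∫ x, M.dEll σ 1 1 M.θ₀ M.θ₀ M.η₀ x ∂M.P|
      ≤ C * ‖η - M.η₀‖
  noBias : ∀ η ∈ M.H, ‖η - M.η₀‖ < δ →
    |∫ x, M.dEll σ 1 0 M.θ₀ M.θ₀ η x ∂M.P| ≤ C * ‖η - M.η₀‖ ^ 2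

/-- All conditions pass to smaller neighbourhoods. The conclusion covers every δ ≤ δ₀ so that the
radius can later be reduced to fit the stochastic conditions as well. -/
theorem Regular.exists_localRegular {D : Type*} {γ : D → ℝ → E} {hS : MemLp M.score 2 M.P}
    (hM : M.Regular γ hS σ) : ∃ δ₀ > 0, ∃ F G : 𝒳 → ℝ, ∃ C : ℝ, ∀ δ, 0 < δ → δ ≤ δ₀ →
      M.LocalRegular σ δ F G C := by
  obtain ⟨δ₁, hδ₁, h₁⟩ := hM.domain
  obtain ⟨δ₂, hδ₂, h₂, F, hF, hFb⟩ := hM.smooth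
  obtain ⟨δ₃, hδ₃, h₃, G, hG, hGb⟩ := hM.dominated
  obtain ⟨δ₄, hδ₄, h₄, h₄', -⟩ := hM.donsker
  obtain ⟨δ₅, hδ₅, C₅, h₅⟩ := hM.mean_tt
  obtain ⟨δ₆, hδ₆, C₆, h₆⟩ := hM.mean_tθ
  obtain ⟨δ₇, hδ₇, C₇, h₇⟩ := hM.noBias
  refine ⟨min δ₁ (min δ₂ (min δ₃ (min δ₄ (min δ₅ (min δ₆ δ₇))))), by
    simp only [gt_iff_lt, lt_min_iff]; tauto, F, G, max C₅ (max C₆ C₇), fun δ hδ hle => ?_⟩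
  simp only [le_min_iff] at hle
  obtain ⟨l₁, l₂, l₃, l₄, l₅, l₆, l₇⟩ := hle
  have hball := Metric.ball_subset_ball (x := M.θ₀) l₃
  exact
    { pos := hδ
      through := hM.through
      domain := fun v hv => h₁ v (nhd_mono l₁ hv)
      differentiable_left := fun v hv x => (h₂ v (nhd_mono l₂ hv) x).1
      differentiable_right := fun v hv x => (h₂ v (nhd_mono l₂ hv) x).2
      integrable_envelope := hF
      envelope := fun v hv => hFb v (nhd_mono l₂ hv)
      contDiff := fun x => (h₃ x).mono (Set.prod_mono hball hball)
      integrable_dominating := hG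
      dominated := fun t ht θ hθ => hGb t (hball ht) θ (hball hθ)
      memLp_tt := fun v hv => h₄.1 _ ⟨v, nhd_mono l₄ hv, rfl⟩
      memLp_tθ := fun v hv => h₄'.1 _ ⟨v, nhd_mono l₄ hv, rfl⟩
      mean_tt := fun η hη h => (h₅ η hη (h.trans_le l₅)).trans
        (mul_le_mul_of_nonneg_right (le_max_left _ _) (norm_nonneg _))
      mean_tθ := fun η hη h => (h₆ η hη (h.trans_le l₆)).trans
        (mul_le_mul_of_nonneg_right ((le_max_left _ _).trans (le_max_right _ _)) (norm_nonneg _))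
      noBias := fun η hη h => (h₇ η hη (h.trans_le l₇)).trans
        (mul_le_mul_of_nonneg_right ((le_max_right _ _).trans (le_max_right _ _))
          (sq_nonneg _)) }

/-! ### Score identities at the truth -/

namespace LocalRegular

variable {δ C : ℝ} {F G : 𝒳 → ℝ}

theorem hasDerivAt_left (h : M.LocalRegular σ δ F G C) {t θ : ℝ} {η : E}
    (hv : (t, θ, η) ∈ M.nhd δ) (x : 𝒳) {l : ℕ} (hl : l ∈ ({0, 1, 2} : Set ℕ)) :
    HasDerivAt (fun t => M.dEll σ l 0 t θ η x) (M.dEll σ (l + 1) 0 t θ η x) t := by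
  rw [← deriv_dEll_left]
  exact (h.differentiable_left _ hv x l hl).hasDerivAt

theorem hasDerivAt_right (h : M.LocalRegular σ δ F G C) {t θ : ℝ} {η : E}
    (hv : (t, θ, η) ∈ M.nhd δ) (x : 𝒳) {l m : ℕ}
    (hl : (l, m) ∈ ({(1, 0), (1, 1), (2, 0)} : Set (ℕ × ℕ))) :
    HasDerivAt (fun θ => M.dEll σ l m t θ η x) (M.dEll σ l (m + 1) t θ η x) θ := by
  rw [← deriv_dEll_right]
  exact (h.differentiable_right _ hv x (l, m) hl).hasDerivAt

theorem differentiableAt_density (h : M.LocalRegular σ δ F G C) {t θ : ℝ} (ht : |t - M.θ₀| < δ)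
    (hθ : |θ - M.θ₀| < δ) (x : 𝒳) :
    DifferentiableAt ℝ (fun u : ℝ × ℝ => M.p u.1 (σ u.1 u.2 M.η₀) x) (t, θ) := by
  refine ((h.contDiff x).differentiableOn one_ne_zero).differentiableAt
    (prod_mem_nhds (Metric.isOpen_ball.mem_nhds ?_) (Metric.isOpen_ball.mem_nhds ?_))
  · simpa [Metric.mem_ball, Real.dist_eq] using ht
  · simpa [Metric.mem_ball, Real.dist_eq] using hθ

theorem differentiableAt_density_right (h : M.LocalRegular σ δ F G C) {t θ : ℝ} (ht : |t - M.θ₀| < δ)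
    (hθ : |θ - M.θ₀| < δ) (x : 𝒳) :
    DifferentiableAt ℝ (fun θ => M.p t (σ t θ M.η₀) x) θ :=
  DifferentiableAt.comp (f := fun θ : ℝ => (t, θ)) θ (h.differentiableAt_density ht hθ x)
    (by fun_prop)

/-- Chain rule for the logarithm at a positive density. Holding on a whole neighbourhood, the
identity can be differentiated again in t or θ. -/
theorem dDens_one_zero_eq (h : M.LocalRegular σ δ F G C) {t θ : ℝ} (ht : |t - M.θ₀| < δ)
    (hθ : |θ - M.θ₀| < δ) (x : 𝒳) :
    M.dDens σ 1 0 t θ M.η₀ x = M.p t (σ t θ M.η₀) x * M.dEll σ 1 0 t θ M.η₀ x ∧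
    HasDerivAt (fun t => M.p t (σ t θ M.η₀) x) (M.dDens σ 1 0 t θ M.η₀ x) t := by
  have hd : DifferentiableAt ℝ (fun t => M.p t (σ t θ M.η₀) x) t :=
    DifferentiableAt.comp (f := fun t : ℝ => (t, θ)) t (h.differentiableAt_density ht hθ x)
      (by fun_prop)
  have hp := (h.domain _ (mem_nhd_center h.pos ht hθ)).2.2.2 x
  refine ⟨?_, by rw [dDens_one_zero]; exact hd.hasDerivAt⟩
  have h1 : M.dEll σ 1 0 t θ M.η₀ x =
      deriv (fun t => M.p t (σ t θ M.η₀) x) t / M.p t (σ t θ M.η₀) x := by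
    rw [← deriv_dEll_left]
    simp only [dEll_zero_zero]
    exact (hd.hasDerivAt.log hp.ne').deriv
  rw [dDens_one_zero, h1, mul_div_cancel₀ _ hp.ne']

theorem hasDerivAt_dDens_left (h : M.LocalRegular σ δ F G C) {t θ : ℝ} (ht : |t - M.θ₀| < δ)
    (hθ : |θ - M.θ₀| < δ) (x : 𝒳) :
    HasDerivAt (fun t => M.dDens σ 1 0 t θ M.η₀ x) (M.p t (σ t θ M.η₀) x *
      (M.dEll σ 1 0 t θ M.η₀ x ^ 2 + M.dEll σ 2 0 t θ M.η₀ x)) t := by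
  obtain ⟨h1, h2⟩ := h.dDens_one_zero_eq ht hθ x
  have h3 := h2.mul (h.hasDerivAt_left (mem_nhd_center h.pos ht hθ) x (l := 1) (by simp))
  have h4 := h3.congr_of_eventuallyEq (f₁ := fun t => M.dDens σ 1 0 t θ M.η₀ x)
    ((eventually_abs_sub_lt ht).mono fun t ht => (h.dDens_one_zero_eq ht hθ x).1)
  refine h4.congr_deriv ?_
  rw [h1]
  ring

theorem hasDerivAt_dDens_right (h : M.LocalRegular σ δ F G C) {t θ : ℝ} (ht : |t - M.θ₀| < δ)
    (hθ : |θ - M.θ₀| < δ) (x : 𝒳) :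
    HasDerivAt (fun θ => M.dDens σ 1 0 t θ M.η₀ x)
      (deriv (fun θ => M.p t (σ t θ M.η₀) x) θ * M.dEll σ 1 0 t θ M.η₀ x +
        M.p t (σ t θ M.η₀) x * M.dEll σ 1 1 t θ M.η₀ x) θ := by
  have h2 := (h.differentiableAt_density_right ht hθ x).hasDerivAt
  have h3 := h2.mul (h.hasDerivAt_right (mem_nhd_center h.pos ht hθ) x (l := 1) (m := 0) (by simp))
  exact h3.congr_of_eventuallyEq (f₁ := fun θ => M.dDens σ 1 0 t θ M.η₀ x)
    ((eventually_abs_sub_lt hθ).mono fun θ hθ => (h.dDens_one_zero_eq ht hθ x).1)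

theorem abs_center (h : M.LocalRegular σ δ F G C) : |M.θ₀ - M.θ₀| < δ := by
  simpa using h.pos

theorem center (h : M.LocalRegular σ δ F G C) : (M.θ₀, M.θ₀, M.η₀) ∈ M.nhd δ :=
  mem_nhd_center h.pos h.abs_center h.abs_center

theorem σ_center (h : M.LocalRegular σ δ F G C) : σ M.θ₀ M.θ₀ M.η₀ = M.η₀ :=
  h.through _ M.θ₀_mem _ M.η₀_mem

theorem measurable_density (h : M.LocalRegular σ δ F G C) {v : ℝ × ℝ × E} (hv : v ∈ M.nhd δ) :
    Measurable (M.p v.1 (σ v.1 v.2.1 v.2.2)) :=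
  M.measurable_p _ (h.domain v hv).1 _ (h.domain v hv).2.2.1

theorem measurable_dDens (h : M.LocalRegular σ δ F G C) {t θ : ℝ} (ht : |t - M.θ₀| < δ)
    (hθ : |θ - M.θ₀| < δ) : Measurable (M.dDens σ 1 0 t θ M.η₀) := by
  have h1 := measurable_deriv_of_eventually (f := fun t x => M.p t (σ t θ M.η₀) x) (t₀ := t)
    ((eventually_abs_sub_lt ht).mono fun t ht =>
      h.measurable_density (mem_nhd_center h.pos ht hθ))
    (fun x => (h.dDens_one_zero_eq ht hθ x).2.differentiableAt)
  simpa only [← dDens_one_zero] using h1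

theorem integrable_dDens (h : M.LocalRegular σ δ F G C) {t θ : ℝ} (ht : |t - M.θ₀| < δ)
    (hθ : |θ - M.θ₀| < δ) : Integrable (M.dDens σ 1 0 t θ M.η₀) M.μ :=
  h.integrable_dominating.mono' (h.measurable_dDens ht hθ).aestronglyMeasurable
    (ae_of_all _ fun x => h.dominated t (mem_ball_of_abs_sub_lt ht) θ (mem_ball_of_abs_sub_lt hθ) x (1, 0)
      (by simp))

theorem integral_dDens_eq_zero (h : M.LocalRegular σ δ F G C) {t θ : ℝ} (ht : |t - M.θ₀| < δ)
    (hθ : |θ - M.θ₀| < δ) : ∫ x, M.dDens σ 1 0 t θ M.η₀ x ∂M.μ = 0 := by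
  have hd := fun t (ht : |t - M.θ₀| < δ) => h.domain _ (mem_nhd_center h.pos ht hθ)
  exact integral_deriv_eq_zero (c := 1) (f := fun t x => M.p t (σ t θ M.η₀) x)
    (f' := fun t x => M.dDens σ 1 0 t θ M.η₀ x) (eventually_abs_sub_lt ht)
    (fun t ht => h.measurable_density (mem_nhd_center h.pos ht hθ))
    (integrable_p (hd t ht).1 (hd t ht).2.2.1)
    (fun t ht x => (h.dDens_one_zero_eq ht hθ x).2) h.integrable_dominating
    (fun t ht x => h.dominated t (mem_ball_of_abs_sub_lt ht) θ (mem_ball_of_abs_sub_lt hθ) x (1, 0) (by simp))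
    (fun t ht => integral_p (hd t ht).1 (hd t ht).2.2.1)

/-- `P ℓ̇(θ₀, θ₀, η₀) = 0`. -/
theorem integral_dEll_one_zero (h : M.LocalRegular σ δ F G C) :
    ∫ x, M.dEll σ 1 0 M.θ₀ M.θ₀ M.η₀ x ∂M.P = 0 := by
  rw [integral_P, ← h.integral_dDens_eq_zero h.abs_center h.abs_center]
  refine integral_congr_ae (ae_of_all _ fun x => ?_)
  simp only [(h.dDens_one_zero_eq h.abs_center h.abs_center x).1, h.σ_center]

/-- Second Bartlett identity: ∫ ∂_t p dμ is zero for all t near θ₀, so ∫ ∂_t² p dμ = 0, and ∂_t² p =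
p(ℓ̇² + ℓ̈). -/
theorem integral_sq_add_dEll_two_zero (h : M.LocalRegular σ δ F G C) :
    ∫ x, (M.dEll σ 1 0 M.θ₀ M.θ₀ M.η₀ x ^ 2 + M.dEll σ 2 0 M.θ₀ M.θ₀ M.η₀ x) ∂M.P = 0 := by
  rw [integral_P]
  have h1 := integral_deriv_eq_zero (c := 0) (f := fun t x => M.dDens σ 1 0 t M.θ₀ M.η₀ x)
    (f' := fun t x => M.dDens σ 2 0 t M.θ₀ M.η₀ x) (eventually_abs_sub_lt h.abs_center)
    (fun t ht => h.measurable_dDens ht h.abs_center)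
    (h.integrable_dDens h.abs_center h.abs_center)
    (fun t ht x => by
      rw [dDens_two_zero]
      exact (h.hasDerivAt_dDens_left ht h.abs_center x).differentiableAt.hasDerivAt)
    h.integrable_dominating
    (fun t ht x => h.dominated t (mem_ball_of_abs_sub_lt ht) _ (mem_ball_of_abs_sub_lt h.abs_center) x (2, 0)
      (by simp))
    (fun t ht => h.integral_dDens_eq_zero ht h.abs_center)
  rw [← h1]
  refine integral_congr_ae (ae_of_all _ fun x => ?_)
  simp only [dDens_two_zero, (h.hasDerivAt_dDens_left h.abs_center h.abs_center x).deriv,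
    h.σ_center]

/-- The derivative of `log p_{θ₀, η_{θ₀}(θ, η₀)}` in `θ` is the difference between the score for
`θ` and the score of the least favorable submodel. -/
theorem deriv_density_right (h : M.LocalRegular σ δ F G C) (x : 𝒳) :
    deriv (fun θ => M.p M.θ₀ (σ M.θ₀ θ M.η₀) x) M.θ₀ =
      M.p M.θ₀ M.η₀ x * (M.score x - M.dEll σ 1 0 M.θ₀ M.θ₀ M.η₀ x) := by
  set Q : ℝ × ℝ → ℝ := fun u => M.p u.1 (σ u.1 u.2 M.η₀) x with hQ
  have hQd : HasFDerivAt Q (fderiv ℝ Q (M.θ₀, M.θ₀)) (M.θ₀, M.θ₀) :=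
    (h.differentiableAt_density h.abs_center h.abs_center x).hasFDerivAt
  set Q' := fderiv ℝ Q (M.θ₀, M.θ₀)
  have h1 : HasDerivAt (fun θ => M.p M.θ₀ (σ M.θ₀ θ M.η₀) x) (Q' (0, 1)) M.θ₀ :=
    HasFDerivAt.comp_hasDerivAt (f := fun θ : ℝ => (M.θ₀, θ)) M.θ₀ hQd
      ((hasDerivAt_const _ _).prodMk (hasDerivAt_id _))
  have h2 : HasDerivAt (fun t => M.p t (σ t M.θ₀ M.η₀) x) (Q' (1, 0)) M.θ₀ :=
    HasFDerivAt.comp_hasDerivAt (f := fun t : ℝ => (t, M.θ₀)) M.θ₀ hQd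
      ((hasDerivAt_id _).prodMk (hasDerivAt_const _ _))
  -- On the diagonal η_t(t, η₀) = η₀, so this directional derivative is that of the original model
  -- and yields the score for θ. By linearity the θ-derivative is the diagonal one minus the
  -- t-derivative.
  have h3 : HasDerivAt (fun t => M.p t (σ t t M.η₀) x) (Q' (1, 1)) M.θ₀ :=
    HasFDerivAt.comp_hasDerivAt (f := fun t : ℝ => (t, t)) M.θ₀ hQd
      ((hasDerivAt_id _).prodMk (hasDerivAt_id _))
  have h4 : HasDerivAt (fun t => M.p t M.η₀ x) (Q' (1, 1)) M.θ₀ := by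
    refine h3.congr_of_eventuallyEq ((eventually_abs_sub_lt h.abs_center).mono fun t ht => ?_)
    have := (h.domain _ (mem_nhd_center h.pos ht ht)).1
    simp only [h.through t this _ M.η₀_mem]
  have hp : 0 < M.p M.θ₀ M.η₀ x := by
    have := (h.domain _ h.center).2.2.2 x
    simpa only [h.σ_center] using this
  have h5 : M.score x = Q' (1, 1) / M.p M.θ₀ M.η₀ x := (h4.log hp.ne').deriv
  have h6 := (h.dDens_one_zero_eq h.abs_center h.abs_center x)
  rw [h.σ_center] at h6
  have h7 : Q' (1, 0) = M.p M.θ₀ M.η₀ x * M.dEll σ 1 0 M.θ₀ M.θ₀ M.η₀ x :=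
    (h2.unique h6.2).trans h6.1
  have h8 : Q' (1, 1) = Q' (1, 0) + Q' (0, 1) := by
    rw [← map_add]
    simp
  rw [h1.deriv, h5, mul_sub, ← h7, mul_div_cancel₀ _ hp.ne', h8]
  ring

/-- The mixed analogue of the Bartlett identity: ∫ ∂_t p dμ = 0 at t = θ₀ is differentiated in θ. -/
theorem integral_nuisance_mul_add_dEll_one_one (h : M.LocalRegular σ δ F G C) :
    ∫ x, ((M.score x - M.dEll σ 1 0 M.θ₀ M.θ₀ M.η₀ x) * M.dEll σ 1 0 M.θ₀ M.θ₀ M.η₀ x +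
      M.dEll σ 1 1 M.θ₀ M.θ₀ M.η₀ x) ∂M.P = 0 := by
  rw [integral_P]
  have h1 := integral_deriv_eq_zero (c := 0) (f := fun θ x => M.dDens σ 1 0 M.θ₀ θ M.η₀ x)
    (f' := fun θ x => M.dDens σ 1 1 M.θ₀ θ M.η₀ x) (eventually_abs_sub_lt h.abs_center)
    (fun t ht => h.measurable_dDens h.abs_center ht)
    (h.integrable_dDens h.abs_center h.abs_center)
    (fun t ht x => by
      rw [dDens_one_one]
      exact (h.hasDerivAt_dDens_right h.abs_center ht x).differentiableAt.hasDerivAt)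
    h.integrable_dominating
    (fun t ht x => h.dominated _ (mem_ball_of_abs_sub_lt h.abs_center) _ (mem_ball_of_abs_sub_lt ht) x (1, 1)
      (by simp))
    (fun t ht => h.integral_dDens_eq_zero h.abs_center ht)
  rw [← h1]
  refine integral_congr_ae (ae_of_all _ fun x => ?_)
  simp only [dDens_one_one, (h.hasDerivAt_dDens_right h.abs_center h.abs_center x).deriv,
    h.σ_center, h.deriv_density_right]
  ring

theorem measurable_dEll_one_zero (h : M.LocalRegular σ δ F G C) {η : E} (hη : η ∈ M.H)
    (hηδ : ‖η - M.η₀‖ < δ) : Measurable (M.dEll σ 1 0 M.θ₀ M.θ₀ η) := by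
  have hv : ∀ t, |t - M.θ₀| < δ → (t, M.θ₀, η) ∈ M.nhd δ := fun t ht =>
    ⟨ht, h.abs_center, hη, hηδ⟩
  have h1 := measurable_deriv_of_eventually (f := fun t x => M.dEll σ 0 0 t M.θ₀ η x) (t₀ := M.θ₀)
    ((eventually_abs_sub_lt h.abs_center).mono fun t ht => by
      simp only [dEll_zero_zero]
      exact (h.measurable_density (hv t ht)).log)
    (fun x => (h.hasDerivAt_left (hv _ h.abs_center) x (l := 0) (by simp)).differentiableAt)
  simpa only [deriv_dEll_left, zero_add] using h1

theorem integrable_dEll_one_zero (h : M.LocalRegular σ δ F G C) {η : E} (hη : η ∈ M.H)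
    (hηδ : ‖η - M.η₀‖ < δ) : Integrable (M.dEll σ 1 0 M.θ₀ M.θ₀ η) M.P :=
  h.integrable_envelope.mono' (h.measurable_dEll_one_zero hη hηδ).aestronglyMeasurable
    (ae_of_all _ fun x => h.envelope (M.θ₀, M.θ₀, η) ⟨h.abs_center, h.abs_center, hη, hηδ⟩ x (1, 0)
      (by simp))

end LocalRegular

/-! ### The information identity and the vanishing mixed derivative -/

section Information

variable {D : Type*} {γ : D → ℝ → E} {hS : MemLp M.score 2 M.P} {δ C : ℝ} {F G : 𝒳 → ℝ}

theorem Regular.memLp_dEll_one_zero (hM : M.Regular γ hS σ) :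
    MemLp (M.dEll σ 1 0 M.θ₀ M.θ₀ M.η₀) 2 M.P :=
  (memLp_congr_ae hM.leastFavorable).mpr (Lp.memLp _)

theorem Regular.efficientInfo_eq (hM : M.Regular γ hS σ) (h : M.LocalRegular σ δ F G C) :
    M.efficientInfo γ hS = ∫ x, M.dEll σ 1 0 M.θ₀ M.θ₀ M.η₀ x ^ 2 ∂M.P := by
  rw [efficientInfo, ← variance_congr hM.leastFavorable, variance_of_integral_eq_zero
    hM.memLp_dEll_one_zero.aemeasurable h.integral_dEll_one_zero]

/-- `P ℓ̈(θ₀, θ₀, η₀) = -Ĩ₀`. -/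
theorem Regular.integral_dEll_two_zero (hM : M.Regular γ hS σ) (h : M.LocalRegular σ δ F G C) :
    ∫ x, M.dEll σ 2 0 M.θ₀ M.θ₀ M.η₀ x ∂M.P = -M.efficientInfo γ hS := by
  have h1 := h.integral_sq_add_dEll_two_zero
  rw [integral_add hM.memLp_dEll_one_zero.integrable_sq
    ((h.memLp_tt _ h.center).integrable one_le_two), ← hM.efficientInfo_eq h] at h1
  linarith

/-- The efficient score is orthogonal to the nuisance tangent space. -/
theorem Regular.integral_nuisance_mul (hM : M.Regular γ hS σ) :
    ∫ x, (M.score x - M.dEll σ 1 0 M.θ₀ M.θ₀ M.η₀ x) * M.dEll σ 1 0 M.θ₀ M.θ₀ M.η₀ x ∂M.P = 0 := by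
  -- With v the score and w its projection, ℓ̇ is v - w and the score minus ℓ̇ is w, so the integral
  -- is the inner product of the two.
  set v : Lp ℝ 2 M.P := hS.toLp M.score with hv
  set w : Lp ℝ 2 M.P := (M.nuisanceSpace γ).starProjection v with hw
  have h1 : inner ℝ (v - w) w = 0 :=
    Submodule.starProjection_inner_eq_zero v w (Submodule.starProjection_apply_mem _ _)
  rw [L2.inner_def] at h1
  rw [← h1]
  refine integral_congr_ae ?_
  have hl : M.dEll σ 1 0 M.θ₀ M.θ₀ M.η₀ =ᵐ[M.P] ⇑(v - w) := hM.leastFavorable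
  filter_upwards [hl, Lp.coeFn_sub v w, hS.coeFn_toLp] with x hx1 hx2 hx3
  rw [hx1, hx2, Pi.sub_apply, hv, hx3, RCLike.inner_apply, conj_trivial]
  ring

/-- `P ℓ_{t,θ}(θ₀, θ₀, η₀) = 0`. -/
theorem Regular.integral_dEll_one_one (hM : M.Regular γ hS σ) (h : M.LocalRegular σ δ F G C) :
    ∫ x, M.dEll σ 1 1 M.θ₀ M.θ₀ M.η₀ x ∂M.P = 0 := by
  have h1 := h.integral_nuisance_mul_add_dEll_one_one
  have h2 : Integrable (fun x => (M.score x - M.dEll σ 1 0 M.θ₀ M.θ₀ M.η₀ x) *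
      M.dEll σ 1 0 M.θ₀ M.θ₀ M.η₀ x) M.P :=
    (hS.sub hM.memLp_dEll_one_zero).integrable_mul hM.memLp_dEll_one_zero
  rwa [integral_add h2 ((h.memLp_tθ _ h.center).integrable one_le_two), hM.integral_nuisance_mul, zero_add] at h1

end Information

end Model

end SemiparametricProfile

namespace SemiparametricProfile

/-! ## Taylor expansions -/

section Taylor

variable {f f' f'' f''' : ℝ → ℝ} {a b B : ℝ}

theorem abs_sub_le_of_mem_uIcc {t : ℝ} (ht : t ∈ Set.uIcc a b) : |t - a| ≤ |b - a| :=
  Set.abs_sub_left_of_mem_uIcc ht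

theorem abs_sub_le_of_abs_deriv_le (hf : ∀ t ∈ Set.uIcc a b, HasDerivAt f (f' t) t)
    (hB : ∀ t ∈ Set.uIcc a b, |f' t| ≤ B) : |f b - f a| ≤ B * |b - a| :=
  Convex.norm_image_sub_le_of_norm_hasDerivWithin_le
    (fun t ht => (hf t ht).hasDerivWithinAt) hB (convex_uIcc a b) Set.left_mem_uIcc
    Set.right_mem_uIcc

/-- Mean value inequality for f minus its Taylor polynomial, whose derivative is bounded by the
estimate one order lower. The sharp factor 1/2 is not needed. -/
theorem abs_taylor_two_le (hf : ∀ t ∈ Set.uIcc a b, HasDerivAt f (f' t) t)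
    (hf' : ∀ t ∈ Set.uIcc a b, HasDerivAt f' (f'' t) t)
    (hB : ∀ t ∈ Set.uIcc a b, |f'' t| ≤ B) :
    |f b - f a - f' a * (b - a)| ≤ B * |b - a| ^ 2 := by
  have hB0 : 0 ≤ B := (abs_nonneg _).trans (hB a Set.left_mem_uIcc)
  have h := abs_sub_le_of_abs_deriv_le (f := fun t => f t - f' a * (t - a))
    (f' := fun t => f' t - f' a) (a := a) (b := b) (B := B * |b - a|) (fun t ht => by
      refine ((hf t ht).sub (((hasDerivAt_id t).sub_const a).const_mul (f' a))).congr_deriv ?_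
      simp) (fun t ht => by
      have hsub := Set.uIcc_subset_uIcc_left ht
      refine (abs_sub_le_of_abs_deriv_le (fun u hu => hf' u (hsub hu))
        fun u hu => hB u (hsub hu)).trans ?_
      exact mul_le_mul_of_nonneg_left (abs_sub_le_of_mem_uIcc ht) hB0)
  have e : f b - f a - f' a * (b - a) = f b - f' a * (b - a) - (f a - f' a * (a - a)) := by ring
  rw [e]
  exact h.trans (le_of_eq (by ring))

theorem abs_taylor_three_le (hf : ∀ t ∈ Set.uIcc a b, HasDerivAt f (f' t) t)
    (hf' : ∀ t ∈ Set.uIcc a b, HasDerivAt f' (f'' t) t)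
    (hf'' : ∀ t ∈ Set.uIcc a b, HasDerivAt f'' (f''' t) t)
    (hB : ∀ t ∈ Set.uIcc a b, |f''' t| ≤ B) :
    |f b - f a - (b - a) * f' a - (b - a) ^ 2 / 2 * f'' a| ≤ |b - a| ^ 3 * B := by
  have hB0 : 0 ≤ B := (abs_nonneg _).trans (hB a Set.left_mem_uIcc)
  have h := abs_sub_le_of_abs_deriv_le
    (f := fun t => f t - f' a * (t - a) - f'' a / 2 * (t - a) ^ 2)
    (f' := fun t => f' t - f' a - f'' a * (t - a)) (a := a) (b := b) (B := B * |b - a| ^ 2)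
    (fun t ht => by
      have h1 := (hasDerivAt_id t).sub_const a
      refine (((hf t ht).sub (h1.const_mul (f' a))).sub
        ((h1.pow 2).const_mul (f'' a / 2))).congr_deriv ?_
      simp
      ring) (fun t ht => by
      have hsub := Set.uIcc_subset_uIcc_left ht
      refine (abs_taylor_two_le (fun u hu => hf' u (hsub hu)) (fun u hu => hf'' u (hsub hu))
        fun u hu => hB u (hsub hu)).trans ?_
      exact mul_le_mul_of_nonneg_left
        (pow_le_pow_left₀ (abs_nonneg _) (abs_sub_le_of_mem_uIcc ht) 2) hB0)
  have e : f b - f a - (b - a) * f' a - (b - a) ^ 2 / 2 * f'' a =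
      f b - f' a * (b - a) - f'' a / 2 * (b - a) ^ 2 -
        (f a - f' a * (a - a) - f'' a / 2 * (a - a) ^ 2) := by ring
  rw [e]
  exact h.trans (le_of_eq (by ring))

theorem abs_sub_lt_of_mem_uIcc {t c δ : ℝ} (ha : |a - c| < δ) (hb : |b - c| < δ)
    (ht : t ∈ Set.uIcc a b) : |t - c| < δ := by
  rw [abs_lt] at *
  rcases Set.mem_uIcc.mp ht with ⟨h1, h2⟩ | ⟨h1, h2⟩ <;> constructor <;> linarith

end Taylor

/-! ## Empirical means -/

section EmpMean

variable {𝒳 : Type*} {n : ℕ} (y : Fin n → 𝒳)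

theorem empMean_sub (f g : 𝒳 → ℝ) :
    empMean y (fun x => f x - g x) = empMean y f - empMean y g := by
  simp only [empMean, Finset.sum_sub_distrib, mul_sub]

theorem empMean_const_mul (c : ℝ) (f : 𝒳 → ℝ) :
    empMean y (fun x => c * f x) = c * empMean y f := by
  simp only [empMean, ← Finset.mul_sum]
  ring

theorem abs_empMean_le {f F : 𝒳 → ℝ} {c : ℝ} (h : ∀ x, |f x| ≤ c * F x) :
    |empMean y f| ≤ c * empMean y F := by
  rw [← empMean_const_mul, empMean, empMean, abs_mul, abs_of_nonneg (by positivity)]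
  exact mul_le_mul_of_nonneg_left ((Finset.abs_sum_le_sum_abs _ _).trans
    (Finset.sum_le_sum fun i _ => h _)) (by positivity)

/-- Splits an empirical mean into its bias part and its stochastic part, which are bounded
separately. For n = 0 both empirical terms vanish and the mean of f would be left over. -/
theorem empMean_eq [MeasurableSpace 𝒳] (P : Measure 𝒳) (hn : 0 < n) (f : 𝒳 → ℝ) :
    empMean y f = ∫ x, f x ∂P + (Real.sqrt n)⁻¹ * empProc P y f := by
  have hn' : (0 : ℝ) < n := by exact_mod_cast hn
  rw [empProc, ← mul_assoc, ← mul_inv, Real.mul_self_sqrt hn'.le, Finset.sum_sub_distrib]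
  simp only [Finset.sum_const, Finset.card_univ, Fintype.card_fin, nsmul_eq_mul]
  rw [mul_sub, inv_mul_cancel_left₀ hn'.ne', empMean]
  ring

end EmpMean

/-! ### Expansions of empirical means of the derivatives -/

namespace Model

variable {𝒳 : Type*} [MeasurableSpace 𝒳] {E : Type*} {M : Model 𝒳 E} {σ : ℝ → ℝ → E → E}

theorem profileLik_eq {n : ℕ} {y : Fin n → 𝒳} {θ : ℝ} {η : E} (hη : η ∈ M.H)
    (h : ∀ η' ∈ M.H, M.lik y θ η' ≤ M.lik y θ η) : M.profileLik y θ = M.lik y θ η := by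
  have : Nonempty M.H := ⟨⟨η, hη⟩⟩
  -- The maximizer also bounds the likelihoods above, so the real supremum is genuine rather than a
  -- default value.
  exact le_antisymm (ciSup_le fun η' => h _ η'.2)
    (le_ciSup (f := fun η' : M.H => M.lik y θ η'.1)
      ⟨M.lik y θ η, by rintro _ ⟨η', rfl⟩; exact h _ η'.2⟩ ⟨η, hη⟩)

variable [NormedAddCommGroup E]

/-- The empirical mean of the envelope and the relevant empirical processes, evaluated at the data
`y`, are bounded by `K`. -/
structure TypicalData (M : Model 𝒳 E) (σ : ℝ → ℝ → E → E) (δ : ℝ) (F : 𝒳 → ℝ) (K : ℝ) {n : ℕ}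
    (y : Fin n → 𝒳) : Prop where
  envelope : empMean y F ≤ K
  tt : ∀ v ∈ M.nhd δ, |empProc M.P y (M.dEll σ 2 0 v.1 v.2.1 v.2.2)| ≤ K
  tθ : ∀ v ∈ M.nhd δ, |empProc M.P y (M.dEll σ 1 1 v.1 v.2.1 v.2.2)| ≤ K
  modulus : ∀ η ∈ M.H, ‖η - M.η₀‖ < δ → |empProc M.P y (fun x =>
    M.dEll σ 1 0 M.θ₀ M.θ₀ η x - M.dEll σ 1 0 M.θ₀ M.θ₀ M.η₀ x)| ≤ K * ‖η - M.η₀‖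

section Expansion

variable {D : Type*} {γ : D → ℝ → E} {hS : MemLp M.score 2 M.P} {δ C K : ℝ} {F G : 𝒳 → ℝ} {n : ℕ}
  {y : Fin n → 𝒳}

/-- First t moves from a to θ₀ at fixed b, then θ moves from b to θ₀. Each leg costs a third-order
derivative, which the envelope dominates. -/
theorem LocalRegular.abs_empMean_dEll_two_zero_sub (h : M.LocalRegular σ δ F G C)
    (hy : M.TypicalData σ δ F K y) {a b : ℝ} {η : E} (hv : (a, b, η) ∈ M.nhd δ) :
    |empMean y (M.dEll σ 2 0 a b η) - empMean y (M.dEll σ 2 0 M.θ₀ M.θ₀ η)| ≤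
      K * (|a - M.θ₀| + |b - M.θ₀|) := by
  obtain ⟨ha, hb, hη, hηδ⟩ := hv
  rw [← empMean_sub, mul_comm]
  refine (abs_empMean_le y (F := F) (c := |a - M.θ₀| + |b - M.θ₀|) fun x => ?_).trans
    (mul_le_mul_of_nonneg_left hy.envelope (by positivity))
  have h1 := abs_sub_le_of_abs_deriv_le (f := fun t => M.dEll σ 2 0 t b η x)
    (f' := fun t => M.dEll σ 3 0 t b η x) (a := M.θ₀) (b := a) (B := F x)
    (fun t ht => h.hasDerivAt_left
      ⟨abs_sub_lt_of_mem_uIcc h.abs_center ha ht, hb, hη, hηδ⟩ x (l := 2) (by simp))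
    (fun t ht => h.envelope (t, b, η)
      ⟨abs_sub_lt_of_mem_uIcc h.abs_center ha ht, hb, hη, hηδ⟩ x (3, 0) (by simp))
  have h2 := abs_sub_le_of_abs_deriv_le (f := fun θ => M.dEll σ 2 0 M.θ₀ θ η x)
    (f' := fun θ => M.dEll σ 2 1 M.θ₀ θ η x) (a := M.θ₀) (b := b) (B := F x)
    (fun t ht => h.hasDerivAt_right
      ⟨h.abs_center, abs_sub_lt_of_mem_uIcc h.abs_center hb ht, hη, hηδ⟩ x (l := 2) (m := 0)
        (by simp))
    (fun t ht => h.envelope (M.θ₀, t, η)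
      ⟨h.abs_center, abs_sub_lt_of_mem_uIcc h.abs_center hb ht, hη, hηδ⟩ x (2, 1) (by simp))
  calc |M.dEll σ 2 0 a b η x - M.dEll σ 2 0 M.θ₀ M.θ₀ η x|
      ≤ |M.dEll σ 2 0 a b η x - M.dEll σ 2 0 M.θ₀ b η x| +
        |M.dEll σ 2 0 M.θ₀ b η x - M.dEll σ 2 0 M.θ₀ M.θ₀ η x| := abs_sub_le _ _ _
    _ ≤ F x * |a - M.θ₀| + F x * |b - M.θ₀| := add_le_add h1 h2
    _ = (|a - M.θ₀| + |b - M.θ₀|) * F x := by ring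

/-- `ℙ_n ℓ̈(a, b, η)` is close to `-Ĩ₀`. -/
theorem Regular.abs_empMean_dEll_two_zero_add (hM : M.Regular γ hS σ)
    (h : M.LocalRegular σ δ F G C) (hn : 0 < n) (hCK : C ≤ K)
    (hy : M.TypicalData σ δ F K y) {a b : ℝ} {η : E} (hv : (a, b, η) ∈ M.nhd δ) :
    |empMean y (M.dEll σ 2 0 a b η) + M.efficientInfo γ hS| ≤
      K * ((Real.sqrt n)⁻¹ + |a - M.θ₀| + |b - M.θ₀| + ‖η - M.η₀‖) := by
  have h1 := h.abs_empMean_dEll_two_zero_sub hy hv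
  obtain ⟨ha, hb, hη, hηδ⟩ := hv
  have h2 := h.mean_tt η hη hηδ
  rw [hM.integral_dEll_two_zero h, sub_neg_eq_add] at h2
  have h3 := hy.tt (M.θ₀, M.θ₀, η) ⟨h.abs_center, h.abs_center, hη, hηδ⟩
  have h4 := empMean_eq y M.P hn (M.dEll σ 2 0 M.θ₀ M.θ₀ η)
  have h5 : |(Real.sqrt n)⁻¹ * empProc M.P y (M.dEll σ 2 0 M.θ₀ M.θ₀ η)| ≤ (Real.sqrt n)⁻¹ * K := by
    rw [abs_mul, abs_of_nonneg (by positivity : (0 : ℝ) ≤ (Real.sqrt n)⁻¹)]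
    exact mul_le_mul_of_nonneg_left h3 (by positivity)
  have h6 : C * ‖η - M.η₀‖ ≤ K * ‖η - M.η₀‖ := mul_le_mul_of_nonneg_right hCK (norm_nonneg _)
  rw [h4] at h1
  -- Three errors: moving (a, b) to (θ₀, θ₀), moving η to η₀ in the mean, and the empirical
  -- fluctuation.
  have e : empMean y (M.dEll σ 2 0 a b η) + M.efficientInfo γ hS =
      (empMean y (M.dEll σ 2 0 a b η) - (∫ x, M.dEll σ 2 0 M.θ₀ M.θ₀ η x ∂M.P +
        (Real.sqrt n)⁻¹ * empProc M.P y (M.dEll σ 2 0 M.θ₀ M.θ₀ η))) +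
      (∫ x, M.dEll σ 2 0 M.θ₀ M.θ₀ η x ∂M.P + M.efficientInfo γ hS) +
      (Real.sqrt n)⁻¹ * empProc M.P y (M.dEll σ 2 0 M.θ₀ M.θ₀ η) := by ring
  rw [e]
  refine (abs_add_three _ _ _).trans ?_
  linarith

/-- `ℙ_n ℓ_{t,θ}(θ₀, θ₀, η)` is close to zero. -/
theorem Regular.abs_empMean_dEll_one_one (hM : M.Regular γ hS σ)
    (h : M.LocalRegular σ δ F G C) (hn : 0 < n) (hCK : C ≤ K)
    (hy : M.TypicalData σ δ F K y) {η : E} (hη : η ∈ M.H) (hηδ : ‖η - M.η₀‖ < δ) :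
    |empMean y (M.dEll σ 1 1 M.θ₀ M.θ₀ η)| ≤ K * ((Real.sqrt n)⁻¹ + ‖η - M.η₀‖) := by
  have h2 := h.mean_tθ η hη hηδ
  rw [hM.integral_dEll_one_one h, sub_zero] at h2
  have h3 := hy.tθ (M.θ₀, M.θ₀, η) ⟨h.abs_center, h.abs_center, hη, hηδ⟩
  rw [empMean_eq y M.P hn (M.dEll σ 1 1 M.θ₀ M.θ₀ η)]
  have h5 : |(Real.sqrt n)⁻¹ * empProc M.P y (M.dEll σ 1 1 M.θ₀ M.θ₀ η)| ≤ (Real.sqrt n)⁻¹ * K := by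
    rw [abs_mul, abs_of_nonneg (by positivity : (0 : ℝ) ≤ (Real.sqrt n)⁻¹)]
    exact mul_le_mul_of_nonneg_left h3 (by positivity)
  have h6 : C * ‖η - M.η₀‖ ≤ K * ‖η - M.η₀‖ := mul_le_mul_of_nonneg_right hCK (norm_nonneg _)
  refine (abs_add_le _ _).trans ?_
  linarith

/-- `ℙ_n ℓ̇(θ₀, θ₀, η)` is close to `ℙ_n ℓ̇(θ₀, θ₀, η₀)`. -/
theorem LocalRegular.abs_empMean_dEll_one_zero_sub (h : M.LocalRegular σ δ F G C) (hn : 0 < n)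
    (hCK : C ≤ K) (hy : M.TypicalData σ δ F K y) {η : E} (hη : η ∈ M.H) (hηδ : ‖η - M.η₀‖ < δ) :
    |empMean y (M.dEll σ 1 0 M.θ₀ M.θ₀ η) - empMean y (M.dEll σ 1 0 M.θ₀ M.θ₀ M.η₀)| ≤
      K * ((Real.sqrt n)⁻¹ * ‖η - M.η₀‖ + ‖η - M.η₀‖ ^ 2) := by
  have h2 := h.noBias η hη hηδ
  have h3 := hy.modulus η hη hηδ
  rw [← empMean_sub, empMean_eq y M.P hn, integral_sub (h.integrable_dEll_one_zero hη hηδ)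
    (h.integrable_dEll_one_zero M.η₀_mem (by simpa using h.pos)), h.integral_dEll_one_zero,
    sub_zero]
  refine (abs_add_le _ _).trans ?_
  rw [abs_mul, abs_of_nonneg (by positivity : (0 : ℝ) ≤ (Real.sqrt n)⁻¹)]
  have h5 := mul_le_mul_of_nonneg_left h3 (by positivity : (0 : ℝ) ≤ (Real.sqrt n)⁻¹)
  have h6 : C * ‖η - M.η₀‖ ^ 2 ≤ K * ‖η - M.η₀‖ ^ 2 := mul_le_mul_of_nonneg_right hCK (sq_nonneg _)
  linarith

/-- Quadratic expansion of `ℙ_n ℓ̇(a, b, η)` at `(θ₀, θ₀, η₀)`. -/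
theorem Regular.abs_empMean_dEll_one_zero_expansion (hM : M.Regular γ hS σ)
    (h : M.LocalRegular σ δ F G C) (hn : 0 < n) (hCK : C ≤ K) (hK : 0 ≤ K)
    (hy : M.TypicalData σ δ F K y) {a b : ℝ} {η : E} (hv : (a, b, η) ∈ M.nhd δ) :
    |empMean y (M.dEll σ 1 0 a b η) - empMean y (M.dEll σ 1 0 M.θ₀ M.θ₀ M.η₀) +
      M.efficientInfo γ hS * (a - M.θ₀)| ≤
      2 * K * ((Real.sqrt n)⁻¹ + |a - M.θ₀| + |b - M.θ₀| + ‖η - M.η₀‖) ^ 2 := by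
  obtain ⟨ha, hb, hη, hηδ⟩ := hv
  have hs : 0 ≤ (Real.sqrt n)⁻¹ := by positivity
  have h1 : |empMean y (M.dEll σ 1 0 a b η) - empMean y (M.dEll σ 1 0 M.θ₀ b η) -
      (a - M.θ₀) * empMean y (M.dEll σ 2 0 M.θ₀ b η)| ≤ |a - M.θ₀| ^ 2 * K := by
    rw [← empMean_const_mul, ← empMean_sub, ← empMean_sub]
    refine (abs_empMean_le y (F := F) (c := |a - M.θ₀| ^ 2) fun x => ?_).trans
      (mul_le_mul_of_nonneg_left hy.envelope (by positivity))
    have := abs_taylor_two_le (f := fun t => M.dEll σ 1 0 t b η x)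
      (f' := fun t => M.dEll σ 2 0 t b η x) (f'' := fun t => M.dEll σ 3 0 t b η x)
      (a := M.θ₀) (b := a) (B := F x)
      (fun t ht => h.hasDerivAt_left
        ⟨abs_sub_lt_of_mem_uIcc h.abs_center ha ht, hb, hη, hηδ⟩ x (l := 1) (by simp))
      (fun t ht => h.hasDerivAt_left
        ⟨abs_sub_lt_of_mem_uIcc h.abs_center ha ht, hb, hη, hηδ⟩ x (l := 2) (by simp))
      (fun t ht => h.envelope (t, b, η)
        ⟨abs_sub_lt_of_mem_uIcc h.abs_center ha ht, hb, hη, hηδ⟩ x (3, 0) (by simp))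
    rw [mul_comm (a - M.θ₀), mul_comm (|a - M.θ₀| ^ 2)]
    exact this
  have h2 : |empMean y (M.dEll σ 1 0 M.θ₀ b η) - empMean y (M.dEll σ 1 0 M.θ₀ M.θ₀ η) -
      (b - M.θ₀) * empMean y (M.dEll σ 1 1 M.θ₀ M.θ₀ η)| ≤ |b - M.θ₀| ^ 2 * K := by
    rw [← empMean_const_mul, ← empMean_sub, ← empMean_sub]
    refine (abs_empMean_le y (F := F) (c := |b - M.θ₀| ^ 2) fun x => ?_).trans
      (mul_le_mul_of_nonneg_left hy.envelope (by positivity))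
    have := abs_taylor_two_le (f := fun θ => M.dEll σ 1 0 M.θ₀ θ η x)
      (f' := fun θ => M.dEll σ 1 1 M.θ₀ θ η x) (f'' := fun θ => M.dEll σ 1 2 M.θ₀ θ η x)
      (a := M.θ₀) (b := b) (B := F x)
      (fun t ht => h.hasDerivAt_right
        ⟨h.abs_center, abs_sub_lt_of_mem_uIcc h.abs_center hb ht, hη, hηδ⟩ x (l := 1) (m := 0)
          (by simp))
      (fun t ht => h.hasDerivAt_right
        ⟨h.abs_center, abs_sub_lt_of_mem_uIcc h.abs_center hb ht, hη, hηδ⟩ x (l := 1) (m := 1)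
          (by simp))
      (fun t ht => h.envelope (M.θ₀, t, η)
        ⟨h.abs_center, abs_sub_lt_of_mem_uIcc h.abs_center hb ht, hη, hηδ⟩ x (1, 2) (by simp))
    rw [mul_comm (b - M.θ₀), mul_comm (|b - M.θ₀| ^ 2)]
    exact this
  have h3 := hM.abs_empMean_dEll_two_zero_add h hn hCK hy
    (a := M.θ₀) (b := b) (η := η) ⟨h.abs_center, hb, hη, hηδ⟩
  have h4 := hM.abs_empMean_dEll_one_one h hn hCK hy hη hηδ
  have h5 := h.abs_empMean_dEll_one_zero_sub hn hCK hy hη hηδ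
  rw [sub_self, abs_zero, add_zero] at h3
  have h3' := mul_le_mul_of_nonneg_left h3 (abs_nonneg (a - M.θ₀))
  have h4' := mul_le_mul_of_nonneg_left h4 (abs_nonneg (b - M.θ₀))
  rw [← abs_mul] at h3' h4'
  have hα := abs_nonneg (a - M.θ₀)
  have hβ := abs_nonneg (b - M.θ₀)
  have he := norm_nonneg (η - M.η₀)
  generalize |a - M.θ₀| = α at *
  generalize |b - M.θ₀| = β at *
  generalize ‖η - M.η₀‖ = e at *
  generalize (Real.sqrt n)⁻¹ = s at *
  -- The left side collects the errors of moving t, then θ, then η to the truth; each is quadratic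
  -- in the four small quantities.
  have hsum : K * (α ^ 2 + α * (s + β + e) + β ^ 2 + β * (s + e) + s * e + e ^ 2) ≤
      K * (2 * (s + α + β + e) ^ 2) := by
    refine mul_le_mul_of_nonneg_left ?_ hK
    nlinarith [mul_nonneg hs hα, mul_nonneg hs hβ, mul_nonneg hs he, mul_nonneg hα hβ,
      mul_nonneg hα he, mul_nonneg hβ he, sq_nonneg s, sq_nonneg α, sq_nonneg β, sq_nonneg e]
  rw [abs_le] at *
  constructor <;> linarith

end Expansion

end Model

end SemiparametricProfile

namespace SemiparametricProfile

namespace Model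

variable {𝒳 : Type*} [MeasurableSpace 𝒳] {E : Type*} [NormedAddCommGroup E] {M : Model 𝒳 E}
  {σ : ℝ → ℝ → E → E} {D : Type*} {γ : D → ℝ → E} {hS : MemLp M.score 2 M.P} {δ C K : ℝ}
  {F G : 𝒳 → ℝ} {n : ℕ} {y : Fin n → 𝒳}

/-! ## The likelihood along the least favorable submodel -/

theorem LocalRegular.lik_pos (h : M.LocalRegular σ δ F G C) (y : Fin n → 𝒳) {t b : ℝ} {η : E}
    (hv : (t, b, η) ∈ M.nhd δ) : 0 < M.lik y t (σ t b η) :=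
  Finset.prod_pos fun _ _ => (h.domain _ hv).2.2.2 _

theorem LocalRegular.log_lik (h : M.LocalRegular σ δ F G C) (hn : 0 < n) (y : Fin n → 𝒳)
    {t b : ℝ} {η : E} (hv : (t, b, η) ∈ M.nhd δ) :
    Real.log (M.lik y t (σ t b η)) = n * empMean y (M.dEll σ 0 0 t b η) := by
  have hn' : (n : ℝ) ≠ 0 := by positivity
  rw [lik, Real.log_prod fun i _ => ((h.domain _ hv).2.2.2 _).ne', empMean,
    mul_inv_cancel_left₀ hn']
  simp only [dEll_zero_zero]

theorem LocalRegular.abs_empMean_dEll_zero_zero_expansion (h : M.LocalRegular σ δ F G C)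
    (hy : M.TypicalData σ δ F K y) {a t b : ℝ} {η : E} (hva : (a, b, η) ∈ M.nhd δ)
    (ht : |t - M.θ₀| < δ) :
    |empMean y (M.dEll σ 0 0 t b η) - empMean y (M.dEll σ 0 0 a b η) -
      (t - a) * empMean y (M.dEll σ 1 0 a b η) -
      (t - a) ^ 2 / 2 * empMean y (M.dEll σ 2 0 a b η)| ≤ |t - a| ^ 3 * K := by
  obtain ⟨ha, hb, hη, hηδ⟩ := hva
  have hv : ∀ u ∈ Set.uIcc a t, (u, b, η) ∈ M.nhd δ := fun u hu =>
    ⟨abs_sub_lt_of_mem_uIcc ha ht hu, hb, hη, hηδ⟩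
  rw [← empMean_const_mul, ← empMean_const_mul, ← empMean_sub, ← empMean_sub, ← empMean_sub]
  refine (abs_empMean_le y (F := F) (c := |t - a| ^ 3) fun x => ?_).trans
    (mul_le_mul_of_nonneg_left hy.envelope (by positivity))
  exact abs_taylor_three_le (f := fun t => M.dEll σ 0 0 t b η x)
    (f' := fun t => M.dEll σ 1 0 t b η x) (f'' := fun t => M.dEll σ 2 0 t b η x)
    (f''' := fun t => M.dEll σ 3 0 t b η x)
    (fun u hu => h.hasDerivAt_left (hv u hu) x (l := 0) (by simp))
    (fun u hu => h.hasDerivAt_left (hv u hu) x (l := 1) (by simp))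
    (fun u hu => h.hasDerivAt_left (hv u hu) x (l := 2) (by simp))
    (fun u hu => h.envelope _ (hv u hu) x (3, 0) (by simp))

/-- `a` is a maximum likelihood estimator of `θ` for the data `y`, with `ηa` and `ηb` maximizing
the likelihood in the nuisance parameter at `a` and `b`. -/
structure IsMaximizer (M : Model 𝒳 E) {n : ℕ} (y : Fin n → 𝒳) (a b : ℝ) (ηa ηb : E) : Prop where
  mem_left : a ∈ M.Θ
  mem_right : b ∈ M.Θ
  mem_H_left : ηa ∈ M.H
  mem_H_right : ηb ∈ M.H
  max_left : ∀ η ∈ M.H, M.lik y a η ≤ M.lik y a ηa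
  max_right : ∀ η ∈ M.H, M.lik y b η ≤ M.lik y b ηb
  max : ∀ t ∈ M.Θ, ∀ η ∈ M.H, M.lik y t η ≤ M.lik y a ηa

/-- The score equation: `ℙ_n ℓ̇(θ̂, θ̂, η̂) = 0` at a maximum of the likelihood. -/
theorem LocalRegular.empMean_dEll_one_zero_eq_zero (h : M.LocalRegular σ δ F G C) (hn : 0 < n)
    {a b : ℝ} {ηa ηb : E} (hmax : M.IsMaximizer y a b ηa ηb) (hv : (a, a, ηa) ∈ M.nhd δ) :
    empMean y (M.dEll σ 1 0 a a ηa) = 0 := by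
  have hn' : (0 : ℝ) < n := by exact_mod_cast hn
  have hd : HasDerivAt (fun t => empMean y (M.dEll σ 0 0 t a ηa))
      (empMean y (M.dEll σ 1 0 a a ηa)) a := by
    simp only [empMean]
    exact (HasDerivAt.fun_sum fun i _ =>
      h.hasDerivAt_left hv (y i) (l := 0) (by simp)).const_mul _
  -- For t near a, the pair (t, η_t(a, ηa)) stays in the parameter set and equals the joint
  -- maximizer (a, ηa) at t = a.
  refine IsLocalMax.hasDerivAt_eq_zero ?_ hd
  filter_upwards [eventually_abs_sub_lt hv.1] with t ht
  have hvt : (t, a, ηa) ∈ M.nhd δ := ⟨ht, hv.2⟩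
  have h1 := hmax.max t (h.domain _ hvt).1 _ (h.domain _ hvt).2.2.1
  have h2 := Real.log_le_log (h.lik_pos y hvt) h1
  rw [h.log_lik hn y hvt] at h2
  have h3 := h.log_lik hn y hv
  rw [h.through a hmax.mem_left ηa hmax.mem_H_left] at h3
  rw [h3] at h2
  exact le_of_mul_le_mul_left h2 hn'

/-- Upper and lower bounds of the profile likelihood ratio by the likelihood ratios of least
favorable submodels. -/
theorem LocalRegular.log_profileLik_sub (h : M.LocalRegular σ δ F G C) (hn : 0 < n)
    {a b : ℝ} {ηa ηb : E} (hmax : M.IsMaximizer y a b ηa ηb) (hva : (a, a, ηa) ∈ M.nhd δ)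
    (hvb : (b, b, ηb) ∈ M.nhd δ) :
    n * (empMean y (M.dEll σ 0 0 b a ηa) - empMean y (M.dEll σ 0 0 a a ηa)) ≤
      Real.log (M.profileLik y b) - Real.log (M.profileLik y a) ∧
    Real.log (M.profileLik y b) - Real.log (M.profileLik y a) ≤
      n * (empMean y (M.dEll σ 0 0 b b ηb) - empMean y (M.dEll σ 0 0 a b ηb)) := by
  have hvba : (b, a, ηa) ∈ M.nhd δ := ⟨hvb.1, hva.2⟩
  have hvab : (a, b, ηb) ∈ M.nhd δ := ⟨hva.1, hvb.2⟩
  have ha := h.log_lik hn y hva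
  have hb := h.log_lik hn y hvb
  rw [h.through a hmax.mem_left ηa hmax.mem_H_left] at ha
  rw [h.through b hmax.mem_right ηb hmax.mem_H_right] at hb
  -- Lower bound: η_b(a, ηa) competes with ηb at b. Upper bound: η_a(b, ηb) competes with ηa at a.
  have h1 := Real.log_le_log (h.lik_pos y hvba) (hmax.max_right _ (h.domain _ hvba).2.2.1)
  have h2 := Real.log_le_log (h.lik_pos y hvab) (hmax.max_left _ (h.domain _ hvab).2.2.1)
  rw [h.log_lik hn y hvba, hb] at h1
  rw [h.log_lik hn y hvab, ha] at h2
  rw [profileLik_eq hmax.mem_H_left hmax.max_left, profileLik_eq hmax.mem_H_right hmax.max_right,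
    ha, hb]
  constructor <;> linarith

/-- The maximum likelihood estimator and the nuisance estimators are close to the truth, at the
prescribed rates. -/
structure IsClose (M : Model 𝒳 E) (δ K : ℝ) (n : ℕ) (a b : ℝ) (ηa ηb : E) : Prop where
  left : |a - M.θ₀| < δ
  right : |b - M.θ₀| < δ
  eta_left : ‖ηa - M.η₀‖ < δ
  eta_right : ‖ηb - M.η₀‖ < δ
  rate_left : ‖ηa - M.η₀‖ ≤ K * ((Real.sqrt n)⁻¹ + |a - M.θ₀|)
  rate_right : ‖ηb - M.η₀‖ ≤ K * ((Real.sqrt n)⁻¹ + |b - M.θ₀|)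

end Model

/-! ## Real inequalities -/

/-- The constant in the rate of convergence of the maximum likelihood estimator. -/
noncomputable def rateConst (I K : ℝ) : ℝ := 74 * K ^ 3 / I

/-- The constant in the expansion of the maximum likelihood estimator. -/
noncomputable def scoreConst (I K : ℝ) : ℝ := 18 * K ^ 3 * (1 + rateConst I K) ^ 2

theorem rateConst_nonneg {I K : ℝ} (hI : 0 < I) (hK : 1 ≤ K) : 0 ≤ rateConst I K := by
  rw [rateConst]
  have : 0 ≤ K := by linarith
  positivity

/-- Here s is n^{-1/2}, m the empirical mean of the score, d = θ̂ - θ₀ and e the nuisance error.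
Once α is small, the quadratic term in α is absorbed into I * α, which leaves a bound linear in s;
this rate then sharpens the error of the linearization to order s². -/
theorem rate_of_quadratic_bound {I K s m α e d : ℝ} (hI : 0 < I) (hK : 1 ≤ K) (hs : 0 ≤ s)
    (hs1 : s ≤ 1) (hd : |d| = α) (hm : |m| ≤ K * s) (he : e ≤ K * (s + α)) (he0 : 0 ≤ e)
    (hsmall : α ≤ I / (72 * K ^ 3)) (hq : |-m + I * d| ≤ 2 * K * (s + α + α + e) ^ 2) :
    α ≤ rateConst I K * s ∧ |I * d - m| ≤ scoreConst I K * s ^ 2 := by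
  have hα : 0 ≤ α := hd ▸ abs_nonneg _
  have hK0 : 0 < K := by linarith
  have hr : s + α + α + e ≤ 3 * K * (s + α) := by nlinarith
  have hr2 : (s + α + α + e) ^ 2 ≤ (3 * K * (s + α)) ^ 2 :=
    pow_le_pow_left₀ (by positivity) hr 2
  have hq2 : |I * d - m| ≤ 18 * K ^ 3 * (s + α) ^ 2 := by
    rw [neg_add_eq_sub] at hq
    refine hq.trans ((mul_le_mul_of_nonneg_left hr2 (by positivity)).trans (le_of_eq (by ring)))
  have hIα : I * α ≤ K * s + 18 * K ^ 3 * (s + α) ^ 2 := by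
    have h1 : I * α = |I * d| := by rw [abs_mul, abs_of_pos hI, hd]
    have h2 : |I * d| ≤ |I * d - m| + |m| := by
      have := abs_add_le (I * d - m) m
      rwa [sub_add_cancel] at this
    linarith
  have hα2 : 72 * K ^ 3 * α ≤ I := by
    rwa [le_div_iff₀ (by positivity), mul_comm] at hsmall
  -- The threshold I / (72 K³) is chosen so that half of I * α survives. What remains is I * α / 2 ≤
  -- (1 + 36) K³ s, hence the constant 74.
  have hα3 : 36 * K ^ 3 * α ^ 2 ≤ I * α / 2 := by nlinarith
  have hK3 : K ≤ K ^ 3 := le_self_pow₀ hK (by norm_num)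
  have hs2 : s ^ 2 ≤ s := by nlinarith
  have hsq : (s + α) ^ 2 ≤ 2 * s ^ 2 + 2 * α ^ 2 := by nlinarith [sq_nonneg (s - α)]
  have h4 : 18 * K ^ 3 * (s + α) ^ 2 ≤ 36 * K ^ 3 * s + 36 * K ^ 3 * α ^ 2 := by
    have := mul_le_mul_of_nonneg_left hsq (by positivity : 0 ≤ 18 * K ^ 3)
    have := mul_le_mul_of_nonneg_left hs2 (by positivity : 0 ≤ 36 * K ^ 3)
    linarith
  have h5 : K * s ≤ K ^ 3 * s := mul_le_mul_of_nonneg_right hK3 hs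
  have hfin : α ≤ rateConst I K * s := by
    rw [rateConst, div_mul_eq_mul_div, le_div_iff₀ hI]
    linarith
  refine ⟨hfin, hq2.trans ?_⟩
  have h6 : s + α ≤ (1 + rateConst I K) * s := by linarith
  have h7 := pow_le_pow_left₀ (by positivity) h6 2
  rw [scoreConst]
  calc 18 * K ^ 3 * (s + α) ^ 2 ≤ 18 * K ^ 3 * ((1 + rateConst I K) * s) ^ 2 :=
        mul_le_mul_of_nonneg_left h7 (by positivity)
    _ = _ := by ring

/-- The product is cubic in (s, u), so it is at most a multiple of N times the cube of the larger
variable, and N * s³ = s. -/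
theorem mul_sq_mul_add_le {N s u : ℝ} (hN : 0 ≤ N) (hs : 0 ≤ s) (hu : 0 ≤ u) (hNs : N * s ^ 2 = 1) :
    N * (u ^ 2 * (s + u)) ≤ 2 * (N * u ^ 3 + s) := by
  have hu3 : 0 ≤ N * u ^ 3 := by positivity
  rcases le_total u s with h | h
  · have h1 : N * (u ^ 2 * (s + u)) ≤ N * (s ^ 2 * (2 * s)) := by
      gcongr
      linarith
    have h2 : N * (s ^ 2 * (2 * s)) = 2 * s := by
      calc N * (s ^ 2 * (2 * s)) = (N * s ^ 2) * (2 * s) := by ring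
        _ = 2 * s := by rw [hNs, one_mul]
    linarith
  · have h1 : N * (u ^ 2 * (s + u)) ≤ N * (u ^ 2 * (2 * u)) := by
      gcongr
      linarith
    nlinarith

theorem mul_mul_add_sq_le {N s u : ℝ} (hN : 0 ≤ N) (hs : 0 ≤ s) (hu : 0 ≤ u) (hNs : N * s ^ 2 = 1) :
    N * (u * (s + u) ^ 2) ≤ 4 * (N * u ^ 3 + s) := by
  have hu3 : 0 ≤ N * u ^ 3 := by positivity
  rcases le_total u s with h | h
  · have h1 : N * (u * (s + u) ^ 2) ≤ N * (s * (2 * s) ^ 2) := by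
      gcongr
      linarith
    have h2 : N * (s * (2 * s) ^ 2) = 4 * s := by
      calc N * (s * (2 * s) ^ 2) = (N * s ^ 2) * (4 * s) := by ring
        _ = 4 * s := by rw [hNs, one_mul]
    linarith
  · have h1 : N * (u * (s + u) ^ 2) ≤ N * (u * (2 * u) ^ 2) := by
      gcongr
      linarith
    nlinarith

/-- Here ψ is the averaged log-likelihood ratio over a step d, with ψ₁ and ψ₂ its averaged
derivatives. A first derivative of second order and a second derivative near -I leave only the
quadratic term. -/
theorem abs_taylor_remainder_le {N I d ψ ψ₁ ψ₂ A B K s : ℝ} (hN : 0 ≤ N) (hs : 0 ≤ s)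
    (hNs : N * s ^ 2 = 1) (hA : 0 ≤ A) (hB : 0 ≤ B)
    (hψ : |ψ - d * ψ₁ - d ^ 2 / 2 * ψ₂| ≤ |d| ^ 3 * K)
    (h₁ : |ψ₁| ≤ A * (s + |d|) ^ 2) (h₂ : |ψ₂ + I| ≤ B * (s + |d|)) (hK : 0 ≤ K) :
    |N * ψ + N / 2 * d ^ 2 * I| ≤ (4 * A + B + K) * (N * |d| ^ 3 + s) := by
  have hd := abs_nonneg d
  have e : N * ψ + N / 2 * d ^ 2 * I =
      N * ((ψ - d * ψ₁ - d ^ 2 / 2 * ψ₂) + d * ψ₁ + d ^ 2 / 2 * (ψ₂ + I)) := by ring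
  have b1 : |d * ψ₁| ≤ A * (|d| * (s + |d|) ^ 2) := by
    rw [abs_mul]
    calc |d| * |ψ₁| ≤ |d| * (A * (s + |d|) ^ 2) := mul_le_mul_of_nonneg_left h₁ hd
      _ = _ := by ring
  have b2 : |d ^ 2 / 2 * (ψ₂ + I)| ≤ B / 2 * (|d| ^ 2 * (s + |d|)) := by
    rw [abs_mul, abs_of_nonneg (by positivity : 0 ≤ d ^ 2 / 2), ← sq_abs d]
    calc |d| ^ 2 / 2 * |ψ₂ + I| ≤ |d| ^ 2 / 2 * (B * (s + |d|)) :=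
          mul_le_mul_of_nonneg_left h₂ (by positivity)
      _ = _ := by ring
  have c1 := mul_le_mul_of_nonneg_left (mul_mul_add_sq_le hN hs hd hNs) hA
  have c2 := mul_le_mul_of_nonneg_left (mul_sq_mul_add_le hN hs hd hNs) (by positivity : 0 ≤ B / 2)
  rw [e, abs_mul, abs_of_nonneg hN]
  have b3 := mul_le_mul_of_nonneg_left
    ((abs_add_three _ _ _).trans (add_le_add (add_le_add hψ b1) b2)) hN
  refine b3.trans ?_
  have c3 : N * (|d| ^ 3 * K) ≤ K * (N * |d| ^ 3 + s) := by nlinarith [mul_nonneg hK hs]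
  nlinarith

end SemiparametricProfile

/-! ### Deterministic expansions on typical data -/

namespace SemiparametricProfile

/-- The constant in the bounds of the derivatives of the log-likelihood at the estimators. -/
noncomputable def radiusConst (I K : ℝ) : ℝ := 1 + 2 * rateConst I K + K + K * rateConst I K

/-- The constant in the expansion of the profile likelihood. -/
noncomputable def profileConst (I K : ℝ) : ℝ :=
  4 * (scoreConst I K + 2 * K * radiusConst I K ^ 2) + K * radiusConst I K + K

namespace Model

theorem withHighProb_isMaximizer {𝒳 : Type*} [MeasurableSpace 𝒳] {E : Type*}
    {M : Model 𝒳 E} {Ω : Type*} [MeasurableSpace Ω] {Pr : Measure Ω} {X : ℕ → Ω → 𝒳}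
    {etaHat : ℕ → Ω → ℝ → E} (hη : M.IsNuisanceMLE Pr X etaHat)
    {thetaHat θt : ℕ → Ω → ℝ} (hθ : M.IsMLE Pr X thetaHat) (hθt : ∀ n ω, θt n ω ∈ M.Θ) :
    WithHighProb Pr (fun _ n ω => M.IsMaximizer (dataVec X n ω) (thetaHat n ω) (θt n ω)
      (etaHat n ω (thetaHat n ω)) (etaHat n ω (θt n ω))) := by
  refine WithHighProb.of_ae ?_
  filter_upwards [hη, hθ.max] with n h1 h2
  filter_upwards [h1, h2] with ω h1 h2
  have ha := h1 _ (hθ.mem n ω)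
  have hb := h1 _ (hθt n ω)
  refine ⟨hθ.mem n ω, hθt n ω, ha.1, hb.1, ha.2, hb.2, fun t ht η hη => ?_⟩
  have ht' := h1 t ht
  have h3 := h2 t ht
  rw [profileLik_eq ht'.1 ht'.2, profileLik_eq ha.1 ha.2] at h3
  exact (ht'.2 η hη).trans h3

variable {𝒳 : Type*} [MeasurableSpace 𝒳] {E : Type*} [NormedAddCommGroup E] {M : Model 𝒳 E}
  {σ : ℝ → ℝ → E → E} {D : Type*} {γ : D → ℝ → E} {hS : MemLp M.score 2 M.P} {δ C K : ℝ}
  {F G : 𝒳 → ℝ} {n : ℕ} {y : Fin n → 𝒳}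

theorem inv_sqrt_le_one (hn : 0 < n) : (Real.sqrt n)⁻¹ ≤ 1 :=
  inv_le_one_of_one_le₀ (Real.one_le_sqrt.mpr (by exact_mod_cast hn))

/-- The maximum likelihood estimator is `n^{-1/2}`-consistent and asymptotically linear. -/
theorem Regular.rate_of_typicalData (hM : M.Regular γ hS σ) (h : M.LocalRegular σ δ F G C)
    (hn : 0 < n) (hCK : C ≤ K) (hK : 1 ≤ K) (hy : M.TypicalData σ δ F K y) {a b : ℝ} {ηa ηb : E}
    (hmax : M.IsMaximizer y a b ηa ηb) (hc : M.IsClose δ K n a b ηa ηb)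
    (hsmall : |a - M.θ₀| ≤ M.efficientInfo γ hS / (72 * K ^ 3))
    (hscore : |empMean y (M.dEll σ 1 0 M.θ₀ M.θ₀ M.η₀)| ≤ K * (Real.sqrt n)⁻¹) :
    |a - M.θ₀| ≤ rateConst (M.efficientInfo γ hS) K * (Real.sqrt n)⁻¹ ∧
    |M.efficientInfo γ hS * (a - M.θ₀) - empMean y (M.dEll σ 1 0 M.θ₀ M.θ₀ M.η₀)| ≤
      scoreConst (M.efficientInfo γ hS) K * (Real.sqrt n)⁻¹ ^ 2 := by
  have hva : (a, a, ηa) ∈ M.nhd δ := ⟨hc.left, hc.left, hmax.mem_H_left, hc.eta_left⟩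
  have hq := hM.abs_empMean_dEll_one_zero_expansion h hn hCK (by linarith) hy hva
  rw [h.empMean_dEll_one_zero_eq_zero hn hmax hva, zero_sub] at hq
  exact rate_of_quadratic_bound hM.info_pos hK (by positivity) (inv_sqrt_le_one hn) rfl hscore
    hc.rate_left (norm_nonneg _) hsmall hq

/-- Quadratic expansion of the log profile likelihood at the maximum likelihood estimator. -/
theorem Regular.expansion_of_typicalData (hM : M.Regular γ hS σ) (h : M.LocalRegular σ δ F G C)
    (hn : 0 < n) (hCK : C ≤ K) (hK : 1 ≤ K) (hy : M.TypicalData σ δ F K y) {a b : ℝ} {ηa ηb : E}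
    (hmax : M.IsMaximizer y a b ηa ηb) (hc : M.IsClose δ K n a b ηa ηb)
    (hsmall : |a - M.θ₀| ≤ M.efficientInfo γ hS / (72 * K ^ 3))
    (hscore : |empMean y (M.dEll σ 1 0 M.θ₀ M.θ₀ M.η₀)| ≤ K * (Real.sqrt n)⁻¹) :
    |Real.log (M.profileLik y b) - (Real.log (M.profileLik y a) -
      n / 2 * (b - a) ^ 2 * M.efficientInfo γ hS)| ≤
      profileConst (M.efficientInfo γ hS) K * (n * |b - a| ^ 3 + (Real.sqrt n)⁻¹) := by
  obtain ⟨hrate, hlin⟩ := hM.rate_of_typicalData h hn hCK hK hy hmax hc hsmall hscore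
  have hva : (a, a, ηa) ∈ M.nhd δ := ⟨hc.left, hc.left, hmax.mem_H_left, hc.eta_left⟩
  have hvb : (b, b, ηb) ∈ M.nhd δ := ⟨hc.right, hc.right, hmax.mem_H_right, hc.eta_right⟩
  have hvab : (a, b, ηb) ∈ M.nhd δ := ⟨hva.1, hvb.2⟩
  have hK0 : 0 ≤ K := by linarith
  have hL := rateConst_nonneg hM.info_pos hK
  obtain ⟨hlow, hup⟩ := h.log_profileLik_sub hn hmax hva hvb
  have hTlow := h.abs_empMean_dEll_zero_zero_expansion hy hva hc.right
  -- Both bounds are expanded at t = a, the upper one along the submodel attached to b, so the same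
  -- remainder estimate serves twice.
  have hTup := h.abs_empMean_dEll_zero_zero_expansion hy hvab hc.right
  have hNs : (n : ℝ) * (Real.sqrt n)⁻¹ ^ 2 = 1 := by
    have hn' : (0 : ℝ) < n := by exact_mod_cast hn
    rw [inv_pow, Real.sq_sqrt hn'.le, mul_inv_cancel₀ hn'.ne']
  have hs : 0 ≤ (Real.sqrt n)⁻¹ := by positivity
  have h2a := hM.abs_empMean_dEll_two_zero_add h hn hCK hy hva
  have h2b := hM.abs_empMean_dEll_two_zero_add h hn hCK hy hvab
  have h1b := hM.abs_empMean_dEll_one_zero_expansion h hn hCK hK0 hy hvab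
  have hβ : |b - M.θ₀| ≤ |b - a| + |a - M.θ₀| := abs_sub_le _ _ _
  have hu := abs_nonneg (b - a)
  have hea := hc.rate_left
  have heb := hc.rate_right
  have hT0 : 0 ≤ scoreConst (M.efficientInfo γ hS) K := by
    rw [scoreConst]
    positivity
  set I := M.efficientInfo γ hS
  set L := rateConst I K
  set T := scoreConst I K
  set R := radiusConst I K with hR
  set s := (Real.sqrt n)⁻¹
  have hLs : 0 ≤ L * s := by positivity
  have hKLs : 0 ≤ K * (L * s) := by positivity
  have hR' : R = 1 + 2 * L + K + K * L := hR
  have hR0 : 0 ≤ R := by rw [hR']; positivity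
  have hLu : 0 ≤ L * |b - a| := by positivity
  have hKu : 0 ≤ K * |b - a| := by positivity
  have hKLu : 0 ≤ K * (L * |b - a|) := by positivity
  have hKα : K * |a - M.θ₀| ≤ K * (L * s) := mul_le_mul_of_nonneg_left hrate hK0
  have hKβ : K * |b - M.θ₀| ≤ K * (|b - a| + L * s) :=
    mul_le_mul_of_nonneg_left (by linarith) hK0
  have hra : s + |a - M.θ₀| + |a - M.θ₀| + ‖ηa - M.η₀‖ ≤ R * (s + |b - a|) := by
    rw [hR']
    linarith
  -- Uses |a - θ₀| ≤ L s, |b - θ₀| ≤ |b - a| + L s and ‖ηb - η₀‖ ≤ K(s + |b - θ₀|); the coefficient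
  -- of s is exactly R.
  have hrb : s + |a - M.θ₀| + |b - M.θ₀| + ‖ηb - M.η₀‖ ≤ R * (s + |b - a|) := by
    rw [hR']
    linarith
  have hA : 0 ≤ T + 2 * K * R ^ 2 := by positivity
  have hB : 0 ≤ K * R := by positivity
  have hψ2a : |empMean y (M.dEll σ 2 0 a a ηa) + I| ≤ K * R * (s + |b - a|) :=
    h2a.trans (by rw [mul_assoc]; exact mul_le_mul_of_nonneg_left hra hK0)
  have hψ2b : |empMean y (M.dEll σ 2 0 a b ηb) + I| ≤ K * R * (s + |b - a|) :=
    h2b.trans (by rw [mul_assoc]; exact mul_le_mul_of_nonneg_left hrb hK0)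
  have hψ1a : |empMean y (M.dEll σ 1 0 a a ηa)| ≤ (T + 2 * K * R ^ 2) * (s + |b - a|) ^ 2 := by
    rw [h.empMean_dEll_one_zero_eq_zero hn hmax hva, abs_zero]
    positivity
  -- This is not a score equation, as (b, ηb) replaces (a, ηa). Its linear part, the mean score
  -- minus I(a - θ₀), is O(s²) by the linear expansion of the estimator.
  have hψ1b : |empMean y (M.dEll σ 1 0 a b ηb)| ≤ (T + 2 * K * R ^ 2) * (s + |b - a|) ^ 2 := by
    have e1 : (s + |a - M.θ₀| + |b - M.θ₀| + ‖ηb - M.η₀‖) ^ 2 ≤ (R * (s + |b - a|)) ^ 2 :=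
      pow_le_pow_left₀ (by positivity) hrb 2
    have e2 := mul_le_mul_of_nonneg_left e1 (by positivity : 0 ≤ 2 * K)
    have e3 : T * s ^ 2 ≤ T * (s + |b - a|) ^ 2 :=
      mul_le_mul_of_nonneg_left (pow_le_pow_left₀ hs (by linarith) 2) hT0
    have e4 : (T + 2 * K * R ^ 2) * (s + |b - a|) ^ 2 =
      T * (s + |b - a|) ^ 2 + 2 * K * (R * (s + |b - a|)) ^ 2 := by ring
    rw [e4]
    rw [abs_le] at *
    constructor <;> linarith
  have hlow' := abs_taylor_remainder_le (Nat.cast_nonneg n) hs hNs hA hB hTlow hψ1a hψ2a hK0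
  have hup' := abs_taylor_remainder_le (Nat.cast_nonneg n) hs hNs hA hB hTup hψ1b hψ2b hK0
  have hW : profileConst I K = 4 * (T + 2 * K * R ^ 2) + K * R + K := rfl
  rw [hW]
  rw [abs_le] at hlow' hup' ⊢
  constructor <;> linarith

theorem Regular.linear_expansion_of_typicalData (hM : M.Regular γ hS σ)
    (h : M.LocalRegular σ δ F G C)
    (hn : 0 < n) (hCK : C ≤ K) (hK : 1 ≤ K) (hy : M.TypicalData σ δ F K y) {a b : ℝ} {ηa ηb : E}
    (hmax : M.IsMaximizer y a b ηa ηb) (hc : M.IsClose δ K n a b ηa ηb)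
    (hsmall : |a - M.θ₀| ≤ M.efficientInfo γ hS / (72 * K ^ 3))
    (hscore : |empMean y (M.dEll σ 1 0 M.θ₀ M.θ₀ M.η₀)| ≤ K * (Real.sqrt n)⁻¹) :
    |Real.sqrt n * (a - M.θ₀) - (Real.sqrt n)⁻¹ * ∑ i, M.dEll σ 1 0 M.θ₀ M.θ₀ M.η₀ (y i) *
      (M.efficientInfo γ hS)⁻¹| ≤
      scoreConst (M.efficientInfo γ hS) K / M.efficientInfo γ hS * (Real.sqrt n)⁻¹ := by
  have hlin := (hM.rate_of_typicalData h hn hCK hK hy hmax hc hsmall hscore).2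
  have hI := hM.info_pos
  have hn' : (0 : ℝ) < n := by exact_mod_cast hn
  have hsn : 0 < Real.sqrt n := Real.sqrt_pos.mpr hn'
  have hsq : Real.sqrt n * Real.sqrt n = n := Real.mul_self_sqrt hn'.le
  have hinv : (Real.sqrt n)⁻¹ = Real.sqrt n * (n : ℝ)⁻¹ := by
    rw [eq_mul_inv_iff_mul_eq₀ hn'.ne', inv_mul_eq_iff_eq_mul₀ hsn.ne', hsq]
  rw [← Finset.sum_mul]
  have e : Real.sqrt n * (a - M.θ₀) - (Real.sqrt n)⁻¹ *
      ((∑ i, M.dEll σ 1 0 M.θ₀ M.θ₀ M.η₀ (y i)) * (M.efficientInfo γ hS)⁻¹) =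
      Real.sqrt n / M.efficientInfo γ hS * (M.efficientInfo γ hS * (a - M.θ₀) -
        empMean y (M.dEll σ 1 0 M.θ₀ M.θ₀ M.η₀)) := by
    rw [hinv, empMean]
    field_simp
  rw [e, abs_mul, abs_of_pos (div_pos hsn hI)]
  refine (mul_le_mul_of_nonneg_left hlin (div_pos hsn hI).le).trans (le_of_eq ?_)
  field_simp

/-! ## Probability of the typical events -/

section Probability

variable {Ω : Type*} [MeasurableSpace Ω] {Pr : Measure Ω}
  {X : ℕ → Ω → 𝒳}

theorem Regular.withHighProb_typicalData [IsProbabilityMeasure Pr] (hM : M.Regular γ hS σ)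
    (hX : M.IsSample Pr X) :
    ∃ δ F G C, M.LocalRegular σ δ F G C ∧
      WithHighProb Pr (fun K n ω => M.TypicalData σ δ F K (dataVec X n ω)) := by
  obtain ⟨δ₀, hδ₀, F, G, C, hloc⟩ := hM.exists_localRegular
  obtain ⟨δ₁, hδ₁, hD2, hD11, -⟩ := hM.donsker
  obtain ⟨δ₂, hδ₂, hmod⟩ := hM.modulus
  have hδ : 0 < min δ₀ (min δ₁ δ₂) := by simp only [lt_min_iff]; exact ⟨hδ₀, hδ₁, hδ₂⟩
  have h := hloc _ hδ (min_le_left _ _)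
  have l₁ : min δ₀ (min δ₁ δ₂) ≤ δ₁ := (min_le_right _ _).trans (min_le_left _ _)
  have l₂ : min δ₀ (min δ₁ δ₂) ≤ δ₂ := (min_le_right _ _).trans (min_le_right _ _)
  refine ⟨_, F, G, C, h, ?_⟩
  have hF0 : ∀ x, 0 ≤ F x := fun x =>
    (abs_nonneg _).trans (h.envelope _ h.center x (0, 0) (by simp))
  have e1 := hX.withHighProb_empMean h.integrable_envelope hF0
  have e2 := hX.withHighProb_of_isDonsker hD2
  have e3 := hX.withHighProb_of_isDonsker hD11
  have e4 : WithHighProb Pr (fun K n ω => ∀ η ∈ M.H, ‖η - M.η₀‖ < δ₂ →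
      |empProc M.P (dataVec X n ω) (fun x =>
        M.dEll σ 1 0 M.θ₀ M.θ₀ η x - M.dEll σ 1 0 M.θ₀ M.θ₀ M.η₀ x)| ≤ K * ‖η - M.η₀‖) := by
    refine hX.withHighProb (B := fun K n y => ∀ η ∈ M.H, ‖η - M.η₀‖ < δ₂ →
      |empProc M.P y (fun x =>
        M.dEll σ 1 0 M.θ₀ M.θ₀ η x - M.dEll σ 1 0 M.θ₀ M.θ₀ M.η₀ x)| ≤ K * ‖η - M.η₀‖)
      (fun C K n y hCK h η hη hηδ => (h η hη hηδ).trans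
        (mul_le_mul_of_nonneg_right hCK (norm_nonneg _))) fun ε hε => ?_
    obtain ⟨C, hC⟩ := hmod ε hε
    refine ⟨C, hC.mono fun n hn => ?_⟩
    convert hn using 4
    push Not
    rfl
  refine (((e1.and e2).and e3).and e4).mono ?_
  rintro K n ω ⟨⟨⟨h1, h2⟩, h3⟩, h4⟩
  exact ⟨h1, fun v hv => h2 _ ⟨v, nhd_mono l₁ hv, rfl⟩, fun v hv => h3 _ ⟨v, nhd_mono l₁ hv, rfl⟩,
    fun η hη hηδ => h4 η hη (hηδ.trans_le l₂)⟩

theorem withHighProb_isClose {etaHat : ℕ → Ω → ℝ → E} (hrate : M.NuisanceRate Pr etaHat)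
    {thetaHat θt : ℕ → Ω → ℝ} (hm : ∀ n, Measurable (thetaHat n))
    (hΘ : ∀ n ω, thetaHat n ω ∈ M.Θ) (hc : TendstoInMeasure Pr thetaHat atTop (fun _ => M.θ₀))
    (hmt : ∀ n, Measurable (θt n)) (hΘt : ∀ n ω, θt n ω ∈ M.Θ)
    (hct : TendstoInMeasure Pr θt atTop (fun _ => M.θ₀)) (hδ : 0 < δ) :
    WithHighProb Pr (fun K n ω => M.IsClose δ K n (thetaHat n ω) (θt n ω)
      (etaHat n ω (thetaHat n ω)) (etaHat n ω (θt n ω))) := by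
  -- With n^{-1/2} and the deviation of θ each below δ / (2K), the rate bound K(n^{-1/2} + |θ - θ₀|)
  -- stays below δ, which puts the nuisance estimators in the neighbourhood.
  have hρ : ∀ K : ℝ, 1 ≤ K → 0 < δ / (2 * K) := fun K hK => by positivity
  have e1 := WithHighProb.of_tendstoInMeasure hc hρ
  have e2 := WithHighProb.of_tendstoInMeasure hct hρ
  have e3 := WithHighProb.of_isBigOP (hrate thetaHat hm hΘ hc)
  have e4 := WithHighProb.of_isBigOP (hrate θt hmt hΘt hct)
  have e5 : WithHighProb Pr (fun K n _ => (Real.sqrt n)⁻¹ < δ / (2 * K)) :=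
    WithHighProb.of_eventually (A := fun K n => (Real.sqrt n)⁻¹ < δ / (2 * K)) fun K hK =>
      (tendsto_inv_atTop_zero.comp (Real.tendsto_sqrt_atTop.comp
        tendsto_natCast_atTop_atTop)).eventually_lt_const (hρ K hK)
  refine (((((WithHighProb.of_le 1).and e1).and e2).and e3).and (e4.and e5)).mono ?_
  rintro K n ω ⟨⟨⟨⟨hK, h1⟩, h2⟩, h3⟩, h4, h5⟩
  rw [abs_norm, abs_of_nonneg (by positivity)] at h3 h4
  have hK0 : 0 < K := by linarith
  have hle : δ / (2 * K) < δ := by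
    rw [div_lt_iff₀ (by positivity)]
    nlinarith
  have hsum : ∀ r, r < δ / (2 * K) → K * ((Real.sqrt n)⁻¹ + r) < δ := fun r hr => by
    calc K * ((Real.sqrt n)⁻¹ + r) < K * (δ / (2 * K) + δ / (2 * K)) :=
          mul_lt_mul_of_pos_left (add_lt_add h5 hr) hK0
      _ = δ := by field_simp; ring
  exact ⟨h1.trans hle, h2.trans hle, h3.trans_lt (hsum _ h1), h4.trans_lt (hsum _ h2), h3, h4⟩

/-- Both expansions hold with high probability. -/
theorem Regular.withHighProb_expansions [IsProbabilityMeasure Pr] (hM : M.Regular γ hS σ)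
    (hX : M.IsSample Pr X)
    {etaHat : ℕ → Ω → ℝ → E} (hη : M.IsNuisanceMLE Pr X etaHat) (hrate : M.NuisanceRate Pr etaHat)
    {thetaHat θt : ℕ → Ω → ℝ} (hθ : M.IsMLE Pr X thetaHat)
    (hc : TendstoInMeasure Pr thetaHat atTop (fun _ => M.θ₀))
    (hmt : ∀ n, Measurable (θt n)) (hΘt : ∀ n ω, θt n ω ∈ M.Θ)
    (hct : TendstoInMeasure Pr θt atTop (fun _ => M.θ₀)) :
    WithHighProb Pr (fun K n ω =>
      |Real.log (M.profileLik (dataVec X n ω) (θt n ω)) -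
        (Real.log (M.profileLik (dataVec X n ω) (thetaHat n ω)) -
          (n : ℝ) / 2 * (θt n ω - thetaHat n ω) ^ 2 * M.efficientInfo γ hS)| ≤
        profileConst (M.efficientInfo γ hS) K *
          (n * |θt n ω - thetaHat n ω| ^ 3 + (Real.sqrt n)⁻¹)) ∧
    WithHighProb Pr (fun K n ω =>
      |Real.sqrt n * (thetaHat n ω - M.θ₀) - (Real.sqrt n)⁻¹ *
        ∑ i : Fin n, M.efficientScore γ hS (X i ω) * (M.efficientInfo γ hS)⁻¹| ≤
        scoreConst (M.efficientInfo γ hS) K / M.efficientInfo γ hS * (Real.sqrt n)⁻¹) := by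
  obtain ⟨δ, F, G, C, h, htyp⟩ := hM.withHighProb_typicalData hX
  have hη₀δ : ‖M.η₀ - M.η₀‖ < δ := by simpa using h.pos
  have hsc := hX.withHighProb_empMean_centered (h.measurable_dEll_one_zero M.η₀_mem hη₀δ)
    hM.memLp_dEll_one_zero h.integral_dEll_one_zero
  have hsmall := WithHighProb.of_tendstoInMeasure hc
    (ρ := fun K => M.efficientInfo γ hS / (72 * K ^ 3)) fun K hK => by
      have := hM.info_pos
      positivity
  have hsum : WithHighProb Pr (fun _ n ω => ∀ i : Fin n,
      M.dEll σ 1 0 M.θ₀ M.θ₀ M.η₀ (X i ω) = M.efficientScore γ hS (X i ω)) := by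
    refine WithHighProb.of_ae (Eventually.of_forall fun n => ae_all_iff.mpr fun i => ?_)
    -- The efficient score is an L₂ class equal to ℓ̇ only P-a.e.; since each observation has law P,
    -- the two agree at the data almost surely.
    exact (hX.map_eq i).quasiMeasurePreserving.ae hM.leastFavorable
  have hall := ((((htyp.and hsc).and hsmall).and hsum).and
    ((withHighProb_isMaximizer hη hθ hΘt).and
      (withHighProb_isClose hrate hθ.measurable hθ.mem hc hmt hΘt hct h.pos))).and
    (((WithHighProb.of_le (Pr := Pr) 1).and (WithHighProb.of_le C)).and
      (WithHighProb.of_eventually (A := fun _ n => 0 < n) fun _ _ => eventually_gt_atTop 0))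
  constructor
  · refine hall.mono ?_
    rintro K n ω ⟨⟨⟨⟨⟨h1, h2⟩, h3⟩, -⟩, h5, h6⟩, ⟨hK, hCK⟩, hn⟩
    exact hM.expansion_of_typicalData h hn hCK hK h1 h5 h6 h3.le h2
  · refine hall.mono ?_
    rintro K n ω ⟨⟨⟨⟨⟨h1, h2⟩, h3⟩, h4⟩, h5, h6⟩, ⟨hK, hCK⟩, hn⟩
    have := hM.linear_expansion_of_typicalData h hn hCK hK h1 h5 h6 h3.le h2
    simp only [dataVec, h4] at this
    exact this

end Probability

end Model

end SemiparametricProfile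

/-! ### Passage to stochastic order symbols -/

theorem theorem1 {𝒳 : Type*} [MeasurableSpace 𝒳] {E : Type*} [NormedAddCommGroup E]
    [NormedSpace ℝ E] {D : Type*} {Ω : Type*} [MeasurableSpace Ω] (Pr : Measure Ω)
    [IsProbabilityMeasure Pr]
    (M : SemiparametricProfile.Model 𝒳 E) (γ : D → ℝ → E) (hS : MemLp M.score 2 M.P)
    (σ : ℝ → ℝ → E → E) (hM : M.Regular γ hS σ)
    (X : ℕ → Ω → 𝒳) (hX : M.IsSample Pr X)
    (etaHat : ℕ → Ω → ℝ → E) (hη : M.IsNuisanceMLE Pr X etaHat) (hrate : M.NuisanceRate Pr etaHat)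
    (thetaHat : ℕ → Ω → ℝ) (hθ : M.IsMLE Pr X thetaHat)
    (hcons : TendstoInMeasure Pr thetaHat atTop (fun _ => M.θ₀)) :
    (∀ θt : ℕ → Ω → ℝ, (∀ n, Measurable (θt n)) → (∀ n ω, θt n ω ∈ M.Θ) →
      TendstoInMeasure Pr (fun n ω => θt n ω - thetaHat n ω) atTop (fun _ => (0 : ℝ)) →
      SemiparametricProfile.IsBigOP Pr
        (fun n ω =>
          Real.log (M.profileLik (SemiparametricProfile.dataVec X n ω) (θt n ω)) -
            (Real.log (M.profileLik (SemiparametricProfile.dataVec X n ω) (thetaHat n ω)) -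
              (n : ℝ) / 2 * (θt n ω - thetaHat n ω) ^ 2 * M.efficientInfo γ hS))
        (fun n ω => (n : ℝ) * |θt n ω - thetaHat n ω| ^ 3 + (Real.sqrt n)⁻¹)) ∧
    SemiparametricProfile.IsBigOP Pr
      (fun n ω =>
        Real.sqrt n * (thetaHat n ω - M.θ₀) -
          (Real.sqrt n)⁻¹ *
            ∑ i : Fin n, M.efficientScore γ hS (X i ω) * (M.efficientInfo γ hS)⁻¹)
      (fun n _ => (Real.sqrt n)⁻¹) := by
  constructor
  · intro θt hm hΘ hdiff
    have hct := SemiparametricProfile.tendstoInMeasure_of_sub hdiff hcons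
    refine SemiparametricProfile.WithHighProb.isBigOP
      (SemiparametricProfile.profileConst (M.efficientInfo γ hS))
      ((hM.withHighProb_expansions hX hη hrate hθ hcons hm hΘ hct).1.mono fun K n ω h => ?_)
    rwa [abs_of_nonneg (a := (n : ℝ) * |θt n ω - thetaHat n ω| ^ 3 + (Real.sqrt n)⁻¹)
      (by positivity)]
  · refine SemiparametricProfile.WithHighProb.isBigOP
      (fun K => SemiparametricProfile.scoreConst (M.efficientInfo γ hS) K / M.efficientInfo γ hS)
      -- The second expansion does not involve θ̃, so θ̂ itself is used as the comparison sequence.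
      ((hM.withHighProb_expansions hX hη hrate hθ hcons hθ.measurable hθ.mem hcons).2.mono
        fun K n ω h => ?_)
    rwa [abs_of_nonneg (a := (Real.sqrt n)⁻¹) (by positivity)]
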